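/- All graphs are finite and simple and are counted up to isomorphism. A *split graph* is a graph $G$ whose vertex set can be written as a disjoint union $V(G)=K\cup S$ of a clique $K$ and a stable set $S$ (either may be empty). A split graph is *balanced* if it has such a partition with $|K|=\omega(G)$ and $|S|=\alpha(G)$, and *unbalanced* otherwise. A graph $G$ is *pseudo-split* if it contains neither $C_4$ nor $2K_2$ as an induced subgraph. A graph $G$ is an *NG-graph* if $\chi(G)+\chi(\overline G)=|V(G)|+1$. Let $A_G=\{v\in V(G):\deg(v)=\chi(G)-1\}$; an NG-graph $G$ is an *NG-1*, *NG-2* or *NG-3 graph* if $G[A_G]$ is a clique, a stable set, or a 5-cycle, respectively. For $n\ge 0$ let $\mathcal S_n,\mathcal U_n,\mathcal B_n,\mathcal{PS}_n,\mathcal{NG}_n$ and $(\mathcal{NG}\text{-}k)_n$ ($k=1,2,3$) denote the sets of isomorphism classes of, respectively, split graphs, unbalanced split graphs, balanced split graphs, pseudo-split graphs, NG-graphs and NG-$k$ graphs on $n$ vertices, and put $s_n=|\mathcal S_n|$ (so $s_0=1$). Then for every $n\ge 1$, where a sum $\sum_{i=0}^{n-5}$ is empty (equal to $0$) if $n<5$: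 1. $|\mathcal U_n|=\sum_{i=0}^{n-1}s_i$; 2. $|\mathcal B_n|=s_n-\sum_{i=0}^{n-1}s_i$; 3. $|(\mathcal{NG}\text{-}1)_n|=|(\mathcal{NG}\text{-}2)_n|=s_{n-1}$; 4. $|(\mathcal{NG}\text{-}3)_n|=\sum_{i=0}^{n-5}s_i$; 5. $|\mathcal{NG}_n|=\sum_{i=0}^{n-1}s_i+\sum_{i=0}^{n-5}s_i$; 6. $|\mathcal{PS}_n|=s_n+\sum_{i=0}^{n-5}s_i$. -/

import Mathlib

namespace SplitNG

open SimpleGraph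

/-- Two labeled graphs on the vertex set `Fin n` are equivalent when they are isomorphic. -/
def isoSetoid (n : ℕ) : Setoid (SimpleGraph (Fin n)) where
  r G H := Nonempty (G ≃g H)
  iseqv :=
    { refl := fun _ => ⟨RelIso.refl _⟩
      symm := fun ⟨e⟩ => ⟨e.symm⟩
      trans := fun ⟨e⟩ ⟨f⟩ => ⟨e.trans f⟩ }

/-- Unlabeled graphs on `n` vertices: isomorphism classes of graphs on `n` vertices. -/
def UnlabeledGraph (n : ℕ) : Type := Quotient (isoSetoid n)

/-- The set of unlabeled graphs on `n` vertices with a representative satisfying `P`.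
All the properties `P` used below are invariant under isomorphism. -/
def unlabeledClass (n : ℕ) (P : SimpleGraph (Fin n) → Prop) : Set (UnlabeledGraph n) :=
  {q | ∃ G : SimpleGraph (Fin n), P G ∧ Quotient.mk (isoSetoid n) G = q}

section Classes

variable {V : Type*}

/-- `(K, S)` is a `KS`-partition of `G`: the vertex set is the disjoint union of the clique `K`
and the stable set `S` (either part may be empty). -/
def IsKSPartition (G : SimpleGraph V) (K S : Finset V) : Prop :=
  Disjoint K S ∧ (∀ v, v ∈ K ∨ v ∈ S) ∧ G.IsClique (K : Set V) ∧ G.IsIndepSet (S : Set V)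

/-- Split graphs. -/
def IsSplit (G : SimpleGraph V) : Prop :=
  ∃ K S : Finset V, IsKSPartition G K S

/-- Balanced split graphs: some `KS`-partition has `|K| = ω(G)` and `|S| = α(G)`. -/
def IsBalanced (G : SimpleGraph V) : Prop :=
  ∃ K S : Finset V, IsKSPartition G K S ∧ K.card = G.cliqueNum ∧ S.card = G.indepNum

/-- Unbalanced split graphs: split graphs that are not balanced. -/
def IsUnbalanced (G : SimpleGraph V) : Prop :=
  IsSplit G ∧ ¬ IsBalanced G

/-- Pseudo-split graphs: no induced `C₄` and no induced `2K₂`. -/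
def IsPseudoSplit (G : SimpleGraph V) : Prop :=
  ¬ (cycleGraph 4).IsIndContained G ∧
    ¬ ((⊤ : SimpleGraph (Fin 2)) ⊕g (⊤ : SimpleGraph (Fin 2))).IsIndContained G

variable [Fintype V]

/-- NG-graphs (Nordhaus-Gaddum graphs): `χ(G) + χ(Gᶜ) = |V(G)| + 1`. -/
def IsNG (G : SimpleGraph V) : Prop :=
  G.chromaticNumber + Gᶜ.chromaticNumber = (Fintype.card V : ℕ∞) + 1

open Classical in
/-- The part `A` of the `ABC`-partition: the vertices `v` with `deg(v) = χ(G) - 1`. -/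
def aPart (G : SimpleGraph V) : Set V :=
  {v | (G.degree v : ℕ∞) + 1 = G.chromaticNumber}

/-- NG-1 graphs: NG-graphs for which `G[A]` is a clique. -/
def IsNG1 (G : SimpleGraph V) : Prop :=
  IsNG G ∧ G.IsClique (aPart G)

/-- NG-2 graphs: NG-graphs for which `G[A]` is a stable set. -/
def IsNG2 (G : SimpleGraph V) : Prop :=
  IsNG G ∧ G.IsIndepSet (aPart G)

/-- NG-3 graphs: NG-graphs for which `G[A]` is a 5-cycle. -/
def IsNG3 (G : SimpleGraph V) : Prop :=
  IsNG G ∧ Nonempty (G.induce (aPart G) ≃g cycleGraph 5)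

end Classes

/-- `s n`: the number of unlabeled split graphs on `n` vertices. -/
noncomputable def splitCount (n : ℕ) : ℕ := (unlabeledClass n IsSplit).ncard

end SplitNG

/-! Every count reduces to one recursion. Call a vertex a swing vertex if its neighbours form a
clique and all other vertices, itself included, form a stable set. A graph has a swing vertex
exactly when it is an unbalanced split graph (`isUnbalanced_iff`). All swing vertices of a graph are
twins of each other, so they form a clique or a stable set.

The structural core is `exists_swing_or_pentagon`: equality in the Nordhaus-Gaddum bound forces
either a swing vertex or a 5-cycle whose outside splits into a clique joined to the cycle and a
stable set not joined to it. The part A is then the set of swing vertices, respectively the 5-cycle,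
so the three kinds of NG-graphs can be read off the structure. A pseudo-split graph is either split
or of this same pentagon type (`isPseudoSplit_iff`).

For the counting, deleting a swing vertex (or the pentagon) leaves a split graph `H` with a marked
clique `K` whose complement is stable. Conversely `comp` rebuilds the graph from the pair. The twin
property, and the invariance of A, make this a bijection between isomorphism classes of graphs and
of pairs `(H, K)`, so pentagon graphs on `m + 5` vertices are as numerous as swing graphs on `m +
1`.

Swing graphs on `m + 1` vertices come in two sorts. If the swing vertices form a clique, `K` is as
large as possible in `H`, hence determined by `H` up to automorphism, and there are `s_m` such
graphs (`ncard_isNG1`). If two of them are nonadjacent, deleting one leaves a swing graph on `m`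
vertices from which the graph is recovered by duplicating a swing vertex (`ncard_hasTwoSwings`).
Hence u_{m+1} = s_m + u_m, and u_n is the sum of the s_i with i < n. NG-2 follows from NG-1 by
complementation. -/

namespace SplitNG

open SimpleGraph

/-! ### Colourings of vertex subsets, and the Nordhaus-Gaddum inequality -/

section Coloring

variable {V : Type*} {G : SimpleGraph V} {X Y Z : Finset V} {k l : ℕ}

/-- The vertices in `X` can be properly coloured with `k` colours. -/
def ColorableOn (G : SimpleGraph V) (X : Finset V) (k : ℕ) : Prop :=
  ∃ f : V → ℕ, (∀ v ∈ X, f v < k) ∧ ∀ u ∈ X, ∀ v ∈ X, G.Adj u v → f u ≠ f v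

theorem ColorableOn.mono (h : ColorableOn G X k) (hY : Y ⊆ X) (hl : k ≤ l) :
    ColorableOn G Y l := by
  obtain ⟨f, h1, h2⟩ := h
  exact ⟨f, fun v hv => (h1 v (hY hv)).trans_le hl, fun u hu v hv => h2 u (hY hu) v (hY hv)⟩

theorem ColorableOn.of_finset {ι : Type*} (f : V → ι) (C : Finset ι) (hf : ∀ v ∈ X, f v ∈ C)
    (h : ∀ u ∈ X, ∀ v ∈ X, G.Adj u v → f u ≠ f v) : ColorableOn G X C.card := by
  classical
  refine ⟨fun v => if hv : f v ∈ C then (C.equivFin ⟨f v, hv⟩ : ℕ) else 0, ?_, ?_⟩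
  · intro v hv
    simp only [hf v hv, dite_true]
    exact Fin.is_lt _
  · intro u hu v hv huv he
    simp only [hf v hv, hf u hu, dite_true] at he
    have := C.equivFin.injective (Fin.ext he)
    exact h u hu v hv huv (by simpa using this)

theorem colorableOn_card (G : SimpleGraph V) (X : Finset V) : ColorableOn G X X.card :=
  ColorableOn.of_finset id X (fun _ h => h) (fun _ _ _ _ h => h.ne)

/-- Spends one new colour on `Y`. Applied to `Gᶜ`, where `Y` is a clique of `G`, chains of this
lemma build clique covers of `G`; that is how the upper bounds below are obtained. -/
theorem ColorableOn.add_indep (h : ColorableOn G X k) (Y : Finset V)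
    (hY : ∀ u ∈ Y, ∀ v ∈ Y, ¬ G.Adj u v) (hZ : ∀ v ∈ Z, v ∈ X ∨ v ∈ Y) :
    ColorableOn G Z (k + 1) := by
  classical
  obtain ⟨f, h1, h2⟩ := h
  refine ⟨fun v => if v ∈ Y then k else f v, fun v hv => ?_, fun u hu v hv huv => ?_⟩
  · by_cases h : v ∈ Y
    · simp [h]
    · have := h1 v ((hZ v hv).resolve_right h)
      simp only [h, if_false]; omega
  · by_cases hu' : u ∈ Y <;> by_cases hv' : v ∈ Y
    · exact absurd huv (hY u hu' v hv')
    · have := h1 v ((hZ v hv).resolve_right hv')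
      simp only [hu', hv', if_true, if_false]; omega
    · have := h1 u ((hZ u hu).resolve_right hu')
      simp only [hu', hv', if_true, if_false]; omega
    · simp only [hu', hv', if_false]
      exact h2 u ((hZ u hu).resolve_right hu') v ((hZ v hv).resolve_right hv') huv

/-- The chromatic number of the subgraph induced by `X`. -/
noncomputable def chi (G : SimpleGraph V) (X : Finset V) : ℕ := sInf {k | ColorableOn G X k}

theorem colorableOn_chi (G : SimpleGraph V) (X : Finset V) : ColorableOn G X (chi G X) :=
  Nat.sInf_mem (s := {k | ColorableOn G X k}) ⟨_, colorableOn_card G X⟩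

theorem chi_le_iff : chi G X ≤ k ↔ ColorableOn G X k :=
  ⟨fun h => (colorableOn_chi G X).mono subset_rfl h, fun h => Nat.sInf_le h⟩

theorem chi_mono (h : Y ⊆ X) : chi G Y ≤ chi G X :=
  chi_le_iff.2 ((colorableOn_chi G X).mono h le_rfl)

variable [DecidableEq V]

theorem chi_le_chi_erase (G : SimpleGraph V) (X : Finset V) (v : V) :
    chi G X ≤ chi G (X.erase v) + 1 :=
  chi_le_iff.2 ((colorableOn_chi G (X.erase v)).add_indep {v} (by simp)
    (fun u hu => by by_cases h : u = v <;> simp [h, hu]))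

/-- The neighbours of `v` in `X`. -/
noncomputable def nbr (G : SimpleGraph V) (X : Finset V) (v : V) : Finset V :=
  open Classical in X.filter (fun u => G.Adj v u)

omit [DecidableEq V] in
@[simp] theorem mem_nbr {u v : V} : u ∈ nbr G X v ↔ u ∈ X ∧ G.Adj v u := by
  simp [nbr]

theorem card_nbr_add_card_nbr_compl {v : V} (hv : v ∈ X) :
    (nbr G X v).card + (nbr Gᶜ X v).card + 1 = X.card := by
  rw [← Finset.card_erase_add_one hv, ← Finset.card_union_of_disjoint]
  · congr 2
    ext u
    simp only [Finset.mem_union, mem_nbr, compl_adj, Finset.mem_erase]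
    have := G.ne_of_adj (a := v) (b := u)
    tauto
  · rw [Finset.disjoint_left]
    intro u hu
    simp only [mem_nbr, compl_adj] at *
    tauto

/-- Greedy step: with fewer than `k` neighbours, `v` finds a colour that none of them uses. -/
theorem ColorableOn.of_erase {v : V} (h : ColorableOn G (X.erase v) k)
    (hd : (nbr G X v).card < k) : ColorableOn G X k := by
  obtain ⟨f, h1, h2⟩ := h
  obtain ⟨c, hc, hc'⟩ : ∃ c ∈ Finset.range k, c ∉ (nbr G X v).image f := by
    by_contra! hcon
    have h3 := Finset.card_le_card (fun c hc => hcon c hc : Finset.range k ⊆ _)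
    have h4 := Finset.card_image_le (s := nbr G X v) (f := f)
    simp only [Finset.card_range] at h3
    omega
  simp only [Finset.mem_image, mem_nbr, not_exists, not_and, Finset.mem_range] at hc hc'
  refine ⟨fun u => if u = v then c else f u, fun u hu => ?_, fun u hu w hw huw => ?_⟩
  · by_cases h : u = v
    · simp [h, hc]
    · simpa [h] using h1 u (by simp [h, hu])
  · by_cases h : u = v <;> by_cases h' : w = v
    · exact absurd (h.trans h'.symm) huw.ne
    · subst h
      simpa [h'] using Ne.symm (hc' w ⟨hw, huw⟩)
    · subst h'
      simpa [h] using (hc' u ⟨hu, huw.symm⟩)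
    · simpa [h, h'] using h2 u (by simp [h, hu]) w (by simp [h', hw]) huw

/-- The Nordhaus-Gaddum inequality. -/
theorem chi_add_chi_compl_le (G : SimpleGraph V) (X : Finset V) :
    chi G X + chi Gᶜ X ≤ X.card + 1 := by
  induction h : X.card generalizing X with
  | zero =>
    have h1 := chi_le_iff.2 (colorableOn_card G X)
    have h2 := chi_le_iff.2 (colorableOn_card Gᶜ X)
    omega
  | succ n ih =>
    obtain ⟨v, hv⟩ : X.Nonempty := Finset.card_pos.1 (by omega)
    have h0 := ih (X.erase v) (by rw [Finset.card_erase_of_mem hv, h]; rfl)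
    have h1 := chi_le_chi_erase G X v
    have h2 := chi_le_chi_erase Gᶜ X v
    have h3 := card_nbr_add_card_nbr_compl (G := G) hv
    -- If `v` can be coloured greedily in `G` or in `Gᶜ`, only one of the two numbers grows.
    -- Otherwise both degrees of `v` are at least the chromatic numbers without `v`; since the
    -- degrees sum to `X.card - 1`, there is room for both to grow by one.
    by_cases h4 : (nbr G X v).card < chi G (X.erase v)
    · have := chi_le_iff.2 ((colorableOn_chi G (X.erase v)).of_erase h4)
      omega
    by_cases h5 : (nbr Gᶜ X v).card < chi Gᶜ (X.erase v)
    · have := chi_le_iff.2 ((colorableOn_chi Gᶜ (X.erase v)).of_erase h5)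
      omega
    omega

omit [DecidableEq V] in
theorem card_le_chi (hY : Y ⊆ X) (h : ∀ u ∈ Y, ∀ v ∈ Y, u ≠ v → G.Adj u v) :
    Y.card ≤ chi G X := by
  obtain ⟨f, h1, h2⟩ := colorableOn_chi G X
  have := Finset.card_le_card_of_injOn (s := Y) (t := Finset.range (chi G X)) f
    (fun v hv => by simpa using h1 v (hY hv))
    (fun u hu v hv he => by
      by_contra hne
      exact h2 u (hY hu) v (hY hv) (h u hu v hv hne) he)
  simpa using this

omit [DecidableEq V] in
theorem chromaticNumber_eq_chi [Fintype V] (G : SimpleGraph V) :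
    G.chromaticNumber = (chi G Finset.univ : ℕ∞) := by
  have key : ∀ k, G.Colorable k ↔ ColorableOn G Finset.univ k := by
    intro k
    constructor
    · rintro ⟨c⟩
      exact ⟨fun v => c v, fun v _ => (c v).2, fun u _ v _ h he => c.valid h (Fin.ext he)⟩
    · rintro ⟨f, h1, h2⟩
      exact ⟨Coloring.mk (fun v => ⟨f v, h1 v (Finset.mem_univ v)⟩) (fun {u v} h he =>
        h2 u (Finset.mem_univ u) v (Finset.mem_univ v) h (by simpa using he))⟩
  apply le_antisymm
  · exact chromaticNumber_le_iff_colorable.2 ((key _).2 (colorableOn_chi _ _))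
  · refine le_chromaticNumber_iff_colorable.2 fun k hk => ?_
    exact_mod_cast chi_le_iff.2 ((key k).1 hk)

end Coloring

/-! ### Swing vertices and pentagons: complements, colour bounds, extension by one vertex -/

section Structure

variable {V : Type*} {G : SimpleGraph V} {X Y Z : Finset V} {k l : ℕ}

/-- In the graph induced by `X`, the neighbours of `a` form a clique, and all the other vertices
(including `a`) form a stable set. -/
structure SwingOn (G : SimpleGraph V) (X : Finset V) (a : V) : Prop where
  mem : a ∈ X
  clique : ∀ u ∈ X, ∀ v ∈ X, G.Adj a u → G.Adj a v → u ≠ v → G.Adj u v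
  indep : ∀ u ∈ X, ∀ v ∈ X, ¬ G.Adj a u → ¬ G.Adj a v → ¬ G.Adj u v

theorem SwingOn.compl {a : V} (h : SwingOn G X a) : SwingOn Gᶜ X a := by
  obtain ⟨h1, h2, h3⟩ := h
  refine ⟨h1, ?_, ?_⟩ <;> simp only [compl_adj] <;> grind [SimpleGraph.Adj.symm]

/-- In the graph induced by `X`, the vertices `f i` form a 5-cycle, every other vertex is
adjacent to all or to none of them, the first ones form a clique and the second ones a
stable set. -/
structure PentagonOn (G : SimpleGraph V) (X : Finset V) (f : Fin 5 → V) : Prop where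
  mem : ∀ i, f i ∈ X
  inj : Function.Injective f
  adj : ∀ i j, G.Adj (f i) (f j) ↔ (j = i + 1 ∨ i = j + 1)
  out : ∀ v ∈ X, (∀ i, f i ≠ v) → (∀ i, G.Adj (f i) v) ∨ (∀ i, ¬ G.Adj (f i) v)
  clique : ∀ u ∈ X, ∀ v ∈ X, (∀ i, G.Adj (f i) u) → (∀ i, G.Adj (f i) v) → u ≠ v → G.Adj u v
  indep : ∀ u ∈ X, ∀ v ∈ X, (∀ i, ¬ G.Adj (f i) u) → (∀ i, ¬ G.Adj (f i) v) → ¬ G.Adj u v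

/-- The complement of a 5-cycle is the 5-cycle traversed with step 2, and complementation exchanges
the clique and the stable part. The multiplier 3 below inverts 2 modulo 5. -/
theorem PentagonOn.compl {f : Fin 5 → V} (h : PentagonOn G X f) :
    PentagonOn Gᶜ X (fun i => f (2 * i)) := by
  have h2 : ∀ i : Fin 5, 2 * (3 * i) = i := by decide
  have hall : ∀ P : V → Prop, (∀ i, P (f (2 * i))) ↔ ∀ i, P (f i) :=
    fun P => ⟨fun h i => h2 i ▸ h (3 * i), fun h i => h _⟩
  have key : ∀ v, (∀ i, ¬ Gᶜ.Adj (f i) v) → ∀ i, G.Adj (f i) v := by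
    intro v hv
    have hne : ∀ i, f i ≠ v := by
      rintro i rfl
      have := hv (i + 2)
      rw [compl_adj, h.adj] at this
      have h3 : ¬ f (i + 2) = f i := fun h' => by
        have h3 : ∀ i : Fin 5, i + 2 ≠ i := by decide
        exact h3 i (h.inj h')
      have h4 : ∀ i : Fin 5, ¬ (i = i + 2 + 1 ∨ i + 2 = i + 1) := by decide
      exact this ⟨h3, h4 i⟩
    intro i
    have := hv i
    rw [compl_adj] at this
    have := hne i
    tauto
  refine ⟨fun i => h.mem _, ?_, ?_, ?_, ?_, ?_⟩
  · intro i j hij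
    have h3 : ∀ i j : Fin 5, 2 * i = 2 * j → i = j := by decide
    exact h3 i j (h.inj hij)
  · intro i j
    rw [compl_adj, h.adj, h.inj.ne_iff]
    revert i j; decide
  · intro v hv hne
    rw [hall (fun w => w ≠ v)] at hne
    rw [hall (fun w => Gᶜ.Adj w v), hall (fun w => ¬ Gᶜ.Adj w v)]
    rcases h.out v hv hne with h' | h'
    · exact Or.inr fun i hi => (compl_adj _ _ _).1 hi |>.2 (h' i)
    · exact Or.inl fun i => (compl_adj _ _ _).2 ⟨hne i, h' i⟩
  · intro u hu v hv hu' hv' huv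
    rw [hall (fun w => Gᶜ.Adj w u)] at hu'
    rw [hall (fun w => Gᶜ.Adj w v)] at hv'
    exact (compl_adj _ _ _).2 ⟨huv, h.indep u hu v hv (fun i => ((compl_adj _ _ _).1 (hu' i)).2)
      (fun i => ((compl_adj _ _ _).1 (hv' i)).2)⟩
  · intro u hu v hv hu' hv' huv
    rw [hall (fun w => ¬ Gᶜ.Adj w u)] at hu'
    rw [hall (fun w => ¬ Gᶜ.Adj w v)] at hv'
    rw [compl_adj] at huv
    exact huv.2 (h.clique u hu v hv (key u hu') (key v hv') huv.1)

theorem SwingOn.chi_le {a : V} (h : SwingOn G X a) : chi G X ≤ (nbr G X a).card + 1 := by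
  classical
  refine chi_le_iff.2 ((colorableOn_card G _).add_indep (X.filter fun u => ¬ G.Adj a u) ?_ ?_)
  · have := h.indep
    simp only [Finset.mem_filter]; grind
  · simp only [Finset.mem_filter, mem_nbr]; grind

/-- The vertices of `X` adjacent to all vertices `f i`. -/
noncomputable def joined {ι : Type*} (G : SimpleGraph V) (X : Finset V) (f : ι → V) : Finset V :=
  open Classical in X.filter (fun u => ∀ i, G.Adj (f i) u)

@[simp] theorem mem_joined {ι : Type*} {f : ι → V} {u : V} :
    u ∈ joined G X f ↔ u ∈ X ∧ ∀ i, G.Adj (f i) u := by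
  simp [joined]

theorem forall_fin5 {P : Fin 5 → Prop} : (∀ i, P i) ↔ P 0 ∧ P 1 ∧ P 2 ∧ P 3 ∧ P 4 :=
  ⟨fun h => ⟨h _, h _, h _, h _, h _⟩, fun ⟨a, b, c, d, e⟩ i => by fin_cases i <;> assumption⟩

theorem joined_two_mul (G : SimpleGraph V) (X : Finset V) (f : Fin 5 → V) :
    joined G X (fun i => f (2 * i)) = joined G X f := by
  ext v
  have h2 : ∀ i : Fin 5, 2 * (3 * i) = i := by decide
  simp only [mem_joined]
  exact and_congr_right fun _ => ⟨fun h i => h2 i ▸ h (3 * i), fun h i => h _⟩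

theorem PentagonOn.mem_cases {f : Fin 5 → V} (h : PentagonOn G X f) {v : V} (hv : v ∈ X) :
    (∃ i, f i = v) ∨ v ∈ joined G X f ∨ v ∈ joined Gᶜ X f := by
  by_cases h' : ∃ i, f i = v
  · exact Or.inl h'
  push Not at h'
  rcases h.out v hv h' with h3 | h3
  · exact Or.inr (Or.inl (by simp [hv, h3]))
  · exact Or.inr (Or.inr (by simp [hv, h3, h']))

theorem PentagonOn.card_eq [DecidableEq V] {f : Fin 5 → V} (h : PentagonOn G X f) :
    X.card = (joined G X f).card + (joined Gᶜ X f).card + 5 := by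
  have h5 : (Finset.univ.image f).card = 5 := by
    rw [Finset.card_image_of_injective _ h.inj]; rfl
  have h1 : Disjoint (joined G X f) (joined Gᶜ X f) := by
    rw [Finset.disjoint_left]
    intro v h1 h2
    have := (mem_joined.1 h1).2 0
    have := (mem_joined.1 h2).2 0
    simp only [compl_adj] at this
    tauto
  have h2 : Disjoint (joined G X f ∪ joined Gᶜ X f) (Finset.univ.image f) := by
    rw [Finset.disjoint_left]
    intro v h1 h2
    obtain ⟨i, -, rfl⟩ := Finset.mem_image.1 h2
    rcases Finset.mem_union.1 h1 with h1 | h1 <;> exact ((mem_joined.1 h1).2 i).ne rfl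
  rw [← Finset.card_union_of_disjoint h1]
  refine Eq.trans ?_ ((Finset.card_union_of_disjoint h2).trans (congrArg _ h5))
  congr 1
  ext v
  simp only [Finset.mem_union, Finset.mem_image, Finset.mem_univ, true_and]
  constructor
  · intro hv
    have := h.mem_cases hv
    tauto
  · rintro ((h1 | h1) | ⟨i, rfl⟩)
    · exact (mem_joined.1 h1).1
    · exact (mem_joined.1 h1).1
    · exact h.mem i

/-- The joined clique gets separate colours; `{f 0, f 2}` with the stable part, `{f 1, f 3}` and `{f
4}` need three more. -/
theorem PentagonOn.chi_le {f : Fin 5 → V} (h : PentagonOn G X f) :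
    chi G X ≤ (joined G X f).card + 3 := by
  classical
  have hadj := h.adj
  refine chi_le_iff.2 ((((colorableOn_card G (joined G X f)).add_indep
    (Z := joined G X f ∪ ({f 0, f 2} ∪ joined Gᶜ X f)) ({f 0, f 2} ∪ joined Gᶜ X f)
      ?_ ?_).add_indep (Z := joined G X f ∪ ({f 0, f 2} ∪ joined Gᶜ X f) ∪ {f 1, f 3})
      {f 1, f 3} ?_ ?_).add_indep {f 4} ?_ ?_)
  · intro u hu v hv huv
    simp only [Finset.mem_union, Finset.mem_insert, Finset.mem_singleton, mem_joined,
      compl_adj] at hu hv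
    rcases hu with (rfl | rfl) | hu <;> rcases hv with (rfl | rfl) | hv
    · exact huv.ne rfl
    · exact absurd ((hadj _ _).1 huv) (by decide)
    · exact (hv.2 0).2 huv
    · exact absurd ((hadj _ _).1 huv) (by decide)
    · exact huv.ne rfl
    · exact (hv.2 2).2 huv
    · exact (hu.2 0).2 huv.symm
    · exact (hu.2 2).2 huv.symm
    · exact h.indep u hu.1 v hv.1 (fun i => (hu.2 i).2) (fun i => (hv.2 i).2) huv
  · exact fun _ h => Finset.mem_union.1 h
  · intro u hu v hv huv
    simp only [Finset.mem_insert, Finset.mem_singleton] at hu hv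
    rcases hu with rfl | rfl <;> rcases hv with rfl | rfl <;>
      exact absurd ((hadj _ _).1 huv) (by decide)
  · exact fun _ h => Finset.mem_union.1 h
  · simp
  · intro v hv
    rcases h.mem_cases hv with ⟨i, rfl⟩ | h1 | h1
    · fin_cases i <;> simp
    · simp only [Finset.mem_union]; tauto
    · simp only [Finset.mem_union]; tauto

variable [DecidableEq V]

theorem SwingOn.extend {a v : V} (h : SwingOn G (X.erase v) a)
    (hS : ¬ ColorableOn Gᶜ X ((nbr Gᶜ (X.erase v) a).card + 1)) : ∃ b, SwingOn G X b := by
  obtain ⟨ha, hK, hI⟩ := h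
  set K := nbr G (X.erase v) a with hKdef
  set S := nbr Gᶜ (X.erase v) a with hSdef
  have hcov : ∀ u ∈ X, u = a ∨ u = v ∨ u ∈ K ∨ u ∈ S := by
    intro u hu
    simp only [hKdef, hSdef, mem_nbr, compl_adj, Finset.mem_erase]
    tauto
  have hK' : ∀ u, u ∈ K ↔ (u ≠ v ∧ u ∈ X) ∧ G.Adj a u := by simp [hKdef]
  have hS' : ∀ u, u ∈ S ↔ (u ≠ v ∧ u ∈ X) ∧ a ≠ u ∧ ¬ G.Adj a u := by simp [hSdef, compl_adj]
  -- An edge `v s` would give a cover of `X` by `S.card + 1` cliques: `{v, s}`, the clique `insert a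
  -- K`, and the other vertices of `S` singly.
  have hvS : ∀ s ∈ S, ¬ G.Adj v s := by
    intro s hs hvs
    apply hS
    have hc : 0 < S.card := Finset.card_pos.2 ⟨s, hs⟩
    have := ((colorableOn_card Gᶜ (S.erase s)).add_indep (Z := S ∪ {v}) {v, s} ?_ ?_).add_indep
      (Z := X) (insert a K) ?_ ?_
    · rwa [Finset.card_erase_of_mem hs, Nat.sub_add_cancel hc] at this
    · simp only [Finset.mem_insert, Finset.mem_singleton, compl_adj]
      grind [SimpleGraph.Adj.symm]
    · simp only [Finset.mem_insert, Finset.mem_singleton, Finset.mem_union, Finset.mem_erase]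
      tauto
    · simp only [Finset.mem_insert, compl_adj, hK']
      simp only [Finset.mem_erase] at hK
      grind [SimpleGraph.Adj.symm]
    · simp only [Finset.mem_insert, Finset.mem_union, Finset.mem_singleton]
      grind
  -- Otherwise each vertex of the clique `insert a K` could be attached to a neighbour in `insert v
  -- S`, again giving a cover by at most `S.card + 1` cliques. This `b` is the swing vertex of `X`.
  obtain ⟨b, hb, hbS⟩ : ∃ b ∈ insert a K, ∀ s ∈ insert v S, ¬ G.Adj b s := by
    by_contra! hcon
    choose! g hg1 hg2 using hcon
    apply hS
    have := ColorableOn.of_finset (G := Gᶜ) (X := X) (fun u => if u ∈ insert a K then g u else u)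
      (insert v S) ?_ ?_
    · exact this.mono subset_rfl (Finset.card_insert_le _ _)
    · intro u hu
      have := hcov u hu
      split_ifs with h
      · exact hg1 u h
      · simp only [Finset.mem_insert] at h ⊢
        tauto
    · intro u hu w hw huw
      have hu1 := hcov u hu
      have hw1 := hcov w hw
      rw [compl_adj] at huw
      split_ifs with h1 h2 h2
      · exfalso
        apply huw.2
        simp only [Finset.mem_erase] at hK
        simp only [Finset.mem_insert, hK'] at h1 h2
        grind [SimpleGraph.Adj.symm]
      · rintro rfl
        exact huw.2 (hg2 u h1)
      · intro he
        have := hg2 w h2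
        rw [← he] at this
        exact huw.2 this.symm
      · exact huw.1
  have hvK : v ∉ insert a K := by
    simp only [Finset.mem_insert, hK']
    simp only [Finset.mem_erase] at ha
    grind
  simp only [Finset.mem_insert, Finset.mem_erase] at *
  refine ⟨b, ?_, ?_, ?_⟩ <;> grind [SimpleGraph.Adj.symm, SimpleGraph.irrefl]

theorem PentagonOn.extend {f : Fin 5 → V} {v : V} (h : PentagonOn G (X.erase v) f)
    (hS : ¬ ColorableOn Gᶜ X ((joined Gᶜ (X.erase v) f).card + 3)) : PentagonOn G X f := by
  set K := joined G (X.erase v) f with hKdef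
  set S := joined Gᶜ (X.erase v) f with hSdef
  have hcov : ∀ u ∈ X, u = v ∨ (∃ i, f i = u) ∨ u ∈ K ∨ u ∈ S := by
    intro u hu
    by_cases h' : u = v
    · exact Or.inl h'
    · exact Or.inr (h.mem_cases (by simp [h', hu]))
  have hadj := h.adj
  have hK' : ∀ u, u ∈ K ↔ (u ≠ v ∧ u ∈ X) ∧ ∀ i, G.Adj (f i) u := by simp [hKdef]
  have hclique := h.clique
  simp only [Finset.mem_erase] at hclique
  have hfK : ∀ i, ∀ x ∈ insert (f i) (insert (f (i+1)) K),
      ∀ y ∈ insert (f i) (insert (f (i+1)) K), ¬ Gᶜ.Adj x y := by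
    intro i
    have := hadj i (i+1)
    simp only [Finset.mem_insert, compl_adj]
    grind [SimpleGraph.Adj.symm]
  have hvf : ∀ i, f i ≠ v := fun i => (Finset.mem_erase.1 (h.mem i)).1
  -- The cover is `{v, s}`, the rest of `S` singly, two disjoint pentagon edges together with `K`,
  -- and the last pentagon vertex: `S.card + 3` cliques.
  have hvS : ∀ s ∈ S, ¬ G.Adj v s := by
    intro s hs hvs
    apply hS
    have hc : 0 < S.card := Finset.card_pos.2 ⟨s, hs⟩
    have := ((((colorableOn_card Gᶜ (S.erase s)).add_indep (Z := S ∪ {v}) {v, s} ?_ ?_).add_indep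
      (Z := S ∪ {v} ∪ (insert (f 0) (insert (f 1) K))) (insert (f 0) (insert (f 1) K))
        (hfK 0) ?_).add_indep (Z := S ∪ {v} ∪ (insert (f 0) (insert (f 1) K)) ∪
          (insert (f 2) (insert (f 3) K)))
          (insert (f 2) (insert (f 3) K)) (hfK 2) ?_).add_indep (Z := X) {f 4} ?_ ?_
    · rwa [Finset.card_erase_of_mem hs, Nat.sub_add_cancel hc] at this
    · simp only [Finset.mem_insert, Finset.mem_singleton, compl_adj]
      grind [SimpleGraph.Adj.symm]
    · simp only [Finset.mem_insert, Finset.mem_singleton, Finset.mem_union, Finset.mem_erase]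
      tauto
    · exact fun _ h => Finset.mem_union.1 h
    · exact fun _ h => Finset.mem_union.1 h
    · simp
    · intro u hu
      simp only [Finset.mem_insert, Finset.mem_union, Finset.mem_singleton]
      rcases hcov u hu with h1 | ⟨i, rfl⟩ | h1 | h1
      · tauto
      · fin_cases i <;> simp
      · tauto
      · tauto
  -- Here the cover is `S` singly, `{f i, v}`, and the two disjoint edges on the remaining pentagon
  -- vertices together with `K`. So `v` can only join the stable part.
  have hvA : ∀ i, ¬ G.Adj (f i) v := by
    intro i hiv
    apply hS
    refine (((colorableOn_card Gᶜ S).add_indep (Z := S ∪ {f i, v}) {f i, v} ?_ ?_).add_indep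
      (Z := S ∪ {f i, v} ∪ (insert (f (i + 1)) (insert (f (i + 1 + 1)) K)))
        (insert (f (i + 1)) (insert (f (i + 1 + 1)) K))
        (hfK (i + 1)) ?_).add_indep (Z := X) (insert (f (i+3)) (insert (f (i + 3 + 1)) K))
         (hfK (i + 3)) ?_
    · simp only [Finset.mem_insert, Finset.mem_singleton, compl_adj]
      grind [SimpleGraph.Adj.symm]
    · exact fun _ h => Finset.mem_union.1 h
    · exact fun _ h => Finset.mem_union.1 h
    · intro u hu
      simp only [Finset.mem_insert, Finset.mem_union, Finset.mem_singleton]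
      rcases hcov u hu with h1 | ⟨j, rfl⟩ | h1 | h1
      · tauto
      · simp only [h.inj.eq_iff]
        have : ∀ i j : Fin 5, j = i ∨ j = i + 1 ∨ j = i + 1 + 1 ∨ j = i + 3 ∨ j = i + 3 + 1 := by
          decide
        have := this i j
        tauto
      · tauto
      · tauto
  have hS' : ∀ u ∈ X, u ≠ v → (∀ i, ¬ G.Adj (f i) u) → u ∈ S := by
    intro u hu huv hn
    simp only [hSdef, mem_joined, compl_adj, Finset.mem_erase]
    refine ⟨⟨huv, hu⟩, fun i => ⟨?_, hn i⟩⟩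
    rintro rfl
    exact hn (i + 1) ((hadj _ _).2 (Or.inr rfl))
  have hindep := h.indep
  simp only [Finset.mem_erase] at hindep
  refine ⟨fun i => (Finset.mem_erase.1 (h.mem i)).2, h.inj, h.adj, ?_, ?_, ?_⟩
  · intro u hu hne
    by_cases huv : u = v
    · subst huv; exact Or.inr hvA
    · exact h.out u (by simp [hu, huv]) hne
  · intro u hu w hw h1 h2 huw
    have hu' : u ≠ v := fun h => hvA 0 (h ▸ h1 0)
    have hw' : w ≠ v := fun h => hvA 0 (h ▸ h2 0)
    exact hclique u ⟨hu', hu⟩ w ⟨hw', hw⟩ h1 h2 huw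
  · intro u hu w hw h1 h2 huw
    by_cases hu' : u = v <;> by_cases hw' : w = v
    · exact huw.ne (hu'.trans hw'.symm)
    · exact hvS w (hS' w hw hw' h2) (hu' ▸ huw)
    · exact hvS u (hS' u hu hu' h1) (hw' ▸ huw.symm)
    · exact hindep u ⟨hu', hu⟩ w ⟨hw', hw⟩ h1 h2 huw

end Structure

/-! ### Equality in the Nordhaus-Gaddum inequality: the induction -/

section Induction

variable {V : Type*} [DecidableEq V] {G : SimpleGraph V} {X : Finset V}

/-- In a double-critical regular graph, adjacent vertices have the same closed neighbourhood. -/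
theorem adj_of_doubleCritical {k : ℕ} (hd : ∀ v ∈ X, (nbr G X v).card = k + 1)
    (hX : ¬ ColorableOn G X (k + 1))
    (hdc : ∀ x ∈ X, ∀ y ∈ X, G.Adj x y → ColorableOn G ((X.erase x).erase y) k)
    {x y z : V} (hx : x ∈ X) (hy : y ∈ X) (hz : z ∈ X) (hxy : G.Adj x y) (hxz : G.Adj x z)
    (hzy : z ≠ y) : G.Adj y z := by
  obtain ⟨f, hf1, hf2⟩ := hdc x hx y hy hxy
  -- If colour `i` misses the common neighbours, give `x` colour `i`, and give the new colour `k` to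
  -- `y` and to the neighbours of `x` that had colour `i`. This is a proper colouring with `k + 1`
  -- colours.
  have hcol : ∀ i < k, ∃ u, u ∈ X ∧ f u = i ∧ G.Adj x u ∧ G.Adj y u := by
    by_contra! hcon
    obtain ⟨i, hi, hcon⟩ := hcon
    apply hX
    classical
    refine ⟨fun u => if u = x then i else if u = y then k else
      if f u = i ∧ G.Adj x u then k else f u, fun u hu => ?_, fun u hu w hw huw => ?_⟩
    · have := hf1 u
      simp only [Finset.mem_erase] at this
      grind
    · have h1 := hf1 u
      have h2 := hf1 w
      have h3 := hf2 u
      simp only [Finset.mem_erase] at h1 h2 h3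
      have h4 := hcon u hu
      have h5 := hcon w hw
      have h6 := huw.ne
      have h8 := huw.symm
      grind
  have : Nonempty V := ⟨x⟩
  choose! g hgX hgf hgx hgy using hcol
  have hcard : k ≤ ((nbr G X x).filter fun u => u ∈ nbr G X y).card := by
    have := Finset.card_le_card_of_injOn (s := Finset.range k)
      (t := (nbr G X x).filter fun u => u ∈ nbr G X y) g
      (fun i hi => by
        have hi := Finset.mem_range.1 hi
        simp [hgX i hi, hgx i hi, hgy i hi])
      (fun i hi j hj he => by
        have hi := Finset.mem_range.1 hi
        have hj := Finset.mem_range.1 hj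
        rw [← hgf i hi, ← hgf j hj, he])
    simpa using this
  -- `x` has only `k` neighbours besides `y`, so all of them are common neighbours.
  have hsub : ((nbr G X x).filter fun u => u ∈ nbr G X y) ⊆ (nbr G X x).erase y := by
    intro u hu
    simp only [Finset.mem_filter, mem_nbr, Finset.mem_erase] at *
    exact ⟨hu.2.2.ne', hu.1⟩
  have heq := Finset.eq_of_subset_of_card_le hsub (by
    rw [Finset.card_erase_of_mem (by simp [hy, hxy]), hd x hx]
    simpa using hcard)
  have : z ∈ (nbr G X x).erase y := by simp [hzy, hz, hxz]
  rw [← heq] at this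
  simp only [Finset.mem_filter, mem_nbr] at this
  exact this.2.2

/-- The closed neighbourhood of `x` is a clique on `k + 2` vertices. A vertex `y` not adjacent to
`x` would leave that clique intact in `X.erase y`, which is `k + 1` colourable. -/
theorem isClique_of_doubleCritical {k : ℕ} (hd : ∀ v ∈ X, (nbr G X v).card = k + 1)
    (hX : ¬ ColorableOn G X (k + 1)) (hcr : ∀ v ∈ X, ColorableOn G (X.erase v) (k + 1))
    (hdc : ∀ x ∈ X, ∀ y ∈ X, G.Adj x y → ColorableOn G ((X.erase x).erase y) k)
    {x y : V} (hx : x ∈ X) (hy : y ∈ X) (hxy : x ≠ y) : G.Adj x y := by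
  by_contra hn
  have := card_le_chi (G := G) (X := X.erase y) (Y := insert x (nbr G X x)) ?_ ?_
  · rw [Finset.card_insert_of_notMem (by simp), hd x hx] at this
    have := chi_le_iff.2 (hcr y hy)
    omega
  · intro u hu
    simp only [Finset.mem_insert, mem_nbr, Finset.mem_erase] at *
    rcases hu with rfl | hu
    · exact ⟨hxy, hx⟩
    · exact ⟨fun h => hn (h ▸ hu.2), hu.1⟩
  · intro u hu w hw huw
    simp only [Finset.mem_insert, mem_nbr] at hu hw
    rcases hu with rfl | hu <;> rcases hw with rfl | hw
    · exact absurd rfl huw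
    · exact hw.2
    · exact hu.2.symm
    · exact adj_of_doubleCritical hd hX hdc hx hu.1 hw.1 hu.2 hw.2 huw.symm

/-- By `hNG`, equality also holds on `X.erase v`. The bound on `chi G (X.erase v)` then bounds `chi
Gᶜ (X.erase v)` from below, and its increase at `v` excludes the clique covers ruled out in the two
`extend` lemmas. -/
theorem exists_extend {v : V} (hv : v ∈ X)
    (h : (∃ a, SwingOn G (X.erase v) a) ∨ ∃ f, PentagonOn G (X.erase v) f)
    (hNG : chi G (X.erase v) + chi Gᶜ (X.erase v) = X.card)
    (hc : chi Gᶜ (X.erase v) < chi Gᶜ X) :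
    (∃ a, SwingOn G X a) ∨ ∃ f, PentagonOn G X f := by
  have hcard := Finset.card_erase_add_one hv
  rcases h with ⟨a, h⟩ | ⟨f, h⟩
  · left
    apply h.extend
    have h1 := h.chi_le
    have h2 := card_nbr_add_card_nbr_compl (G := G) h.mem
    rw [← chi_le_iff]
    omega
  · right
    refine ⟨f, h.extend ?_⟩
    have h1 := h.chi_le
    have h2 := h.card_eq
    rw [← chi_le_iff]
    omega

omit [DecidableEq V] in
theorem injective_of_adj_iff {f : Fin 5 → V}
    (hadj : ∀ i j, G.Adj (f i) (f j) ↔ (j = i + 1 ∨ i = j + 1)) : Function.Injective f := by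
  have h1 : ∀ i : Fin 5, i = i + 4 + 1 := by decide
  have h2 : ∀ i j : Fin 5, (i + 1 = j + 1 ∨ j = i + 1 + 1) →
      (i + 4 = j + 1 ∨ j = i + 4 + 1) → i = j := by decide
  intro i j hij
  exact h2 i j ((hadj j (i + 1)).1 (hij ▸ (hadj i (i + 1)).2 (Or.inl rfl)))
    ((hadj j (i + 4)).1 (hij ▸ (hadj i (i + 4)).2 (Or.inr (h1 i))))

omit [DecidableEq V] in
theorem adj_iff_of_five {a b c d e : V} (hab : G.Adj a b) (hbc : G.Adj b c) (hcd : G.Adj c d)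
    (hde : G.Adj d e) (hea : G.Adj e a) (hac : ¬ G.Adj a c) (had : ¬ G.Adj a d)
    (hbd : ¬ G.Adj b d) (hbe : ¬ G.Adj b e) (hce : ¬ G.Adj c e) (i j : Fin 5) :
    G.Adj (![a, b, c, d, e] i) (![a, b, c, d, e] j) ↔ (j = i + 1 ∨ i = j + 1) := by
  have h1 := hab.symm
  have h2 := hbc.symm
  have h3 := hcd.symm
  have h4 := hde.symm
  have h5 := hea.symm
  rw [G.adj_comm] at hac had hbd hbe hce
  have h6 := hac
  have h7 := had
  have h8 := hbd
  have h9 := hbe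
  have h10 := hce
  rw [G.adj_comm] at hac had hbd hbe hce
  fin_cases i <;> fin_cases j <;>
    first
    | exact iff_of_true (by assumption) (by decide)
    | exact iff_of_false (by assumption) (by decide)
    | exact iff_of_false (SimpleGraph.irrefl G) (by decide)

omit [DecidableEq V] in
theorem exists_pentagonOn_of_five {a b c d e : V} (ha : a ∈ X) (hb : b ∈ X) (hc : c ∈ X)
    (hd : d ∈ X) (he : e ∈ X) (hX : ∀ u ∈ X, u = a ∨ u = b ∨ u = c ∨ u = d ∨ u = e)
    (hab : G.Adj a b) (hbc : G.Adj b c) (hcd : G.Adj c d)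
    (hde : G.Adj d e) (hea : G.Adj e a) (hac : ¬ G.Adj a c) (had : ¬ G.Adj a d)
    (hbd : ¬ G.Adj b d) (hbe : ¬ G.Adj b e) (hce : ¬ G.Adj c e) : ∃ f, PentagonOn G X f := by
  have hadj := adj_iff_of_five hab hbc hcd hde hea hac had hbd hbe hce
  have hf : ∀ u ∈ X, ∃ i, ![a, b, c, d, e] i = u := by
    intro u hu
    rcases hX u hu with rfl | rfl | rfl | rfl | rfl
    exacts [⟨0, rfl⟩, ⟨1, rfl⟩, ⟨2, rfl⟩, ⟨3, rfl⟩, ⟨4, rfl⟩]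
  refine ⟨![a, b, c, d, e], ?_, injective_of_adj_iff hadj, hadj, ?_, ?_, ?_⟩
  · rw [forall_fin5]
    exact ⟨ha, hb, hc, hd, he⟩
  · intro u hu hne
    obtain ⟨i, hi⟩ := hf u hu
    exact absurd hi (hne i)
  · intro u hu v hv h1 h2
    obtain ⟨i, rfl⟩ := hf u hu
    exact absurd rfl (h1 i).ne
  · intro u hu v hv h1 h2
    obtain ⟨i, rfl⟩ := hf u hu
    exact absurd ((hadj (i + 1) i).2 (Or.inr rfl)) (h1 (i + 1))

set_option maxHeartbeats 1000000 in
-- Regularity of degree `K.card + 1` pins down every neighbourhood until only the five vertices `a,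
-- x, s, y, k` remain, forming an induced 5-cycle.
theorem SwingOn.exists_pentagon {a x y : V} (hx : x ∈ X) (hy : y ∈ X) (hxy : x ≠ y)
    (hnxy : ¬ G.Adj x y) (h : SwingOn G ((X.erase x).erase y) a) (hax : G.Adj a x)
    (hay : ¬ G.Adj a y)
    (hd : ∀ v ∈ X, (nbr G X v).card = (nbr G ((X.erase x).erase y) a).card + 1)
    (hcr : chi G (X.erase y) ≤ (nbr G ((X.erase x).erase y) a).card + 1)
    (hS : ¬ ColorableOn Gᶜ X ((nbr Gᶜ ((X.erase x).erase y) a).card + 1)) :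
    ∃ f, PentagonOn G X f := by
  obtain ⟨ha, hK, hI⟩ := h
  set K := nbr G ((X.erase x).erase y) a with hKdef
  set S := nbr Gᶜ ((X.erase x).erase y) a with hSdef
  have hK' : ∀ u, u ∈ K ↔ (u ≠ y ∧ u ≠ x ∧ u ∈ X) ∧ G.Adj a u := by simp [hKdef]
  have hS' : ∀ u, u ∈ S ↔ (u ≠ y ∧ u ≠ x ∧ u ∈ X) ∧ a ≠ u ∧ ¬ G.Adj a u := by
    simp [hSdef, compl_adj]
  have hcov : ∀ u ∈ X, u = a ∨ u = x ∨ u = y ∨ u ∈ K ∨ u ∈ S := by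
    intro u hu
    simp only [hK', hS']
    tauto
  simp only [Finset.mem_erase] at ha hK hI
  have hSS : ∀ s ∈ S, ∀ t ∈ S, ¬ G.Adj s t := by
    intro s hs t ht
    rw [hS'] at hs ht
    exact hI s hs.1 t ht.1 hs.2.2 ht.2.2
  have hKK : ∀ s ∈ K, ∀ t ∈ K, s ≠ t → G.Adj s t := by
    intro s hs t ht
    rw [hK'] at hs ht
    exact hK s hs.1 t ht.1 hs.2 ht.2
  -- For `s ≠ t`, the cliques `{x, s}`, `{y, t}`, `insert a K` and `S.card - 2` singletons would
  -- cover `X`.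
  have hSDR : ∀ s ∈ S, ∀ t ∈ S, G.Adj x s → G.Adj y t → s = t := by
    intro s hs t ht hxs hyt
    by_contra hst
    apply hS
    have hc : 1 < S.card := Finset.one_lt_card.2 ⟨s, hs, t, ht, hst⟩
    have ht' : t ∈ S.erase s := by simp [ht, Ne.symm hst]
    have := (((colorableOn_card Gᶜ ((S.erase s).erase t)).add_indep
      (Z := ((S.erase s).erase t) ∪ {x, s}) {x, s} ?_ (fun _ h => Finset.mem_union.1 h)).add_indep
      (Z := ((S.erase s).erase t) ∪ {x, s} ∪ {y, t}) {y, t} ?_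
        (fun _ h => Finset.mem_union.1 h)).add_indep (Z := X) (insert a K) ?_ ?_
    · rw [Finset.card_erase_of_mem ht', Finset.card_erase_of_mem hs] at this
      convert this using 1
      omega
    · simp only [Finset.mem_insert, Finset.mem_singleton, compl_adj]
      grind [SimpleGraph.Adj.symm]
    · simp only [Finset.mem_insert, Finset.mem_singleton, compl_adj]
      grind [SimpleGraph.Adj.symm]
    · simp only [Finset.mem_insert, compl_adj, hK']
      grind [SimpleGraph.Adj.symm]
    · intro u hu
      have := hcov u hu
      simp only [Finset.mem_insert, Finset.mem_singleton, Finset.mem_union, Finset.mem_erase]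
      tauto
  obtain ⟨s, hs, hys⟩ : ∃ s ∈ S, G.Adj y s := by
    by_contra! hcon
    have h1 : nbr G X y ⊆ K := by
      intro u hu
      have hu := mem_nbr.1 hu
      have := hcov u hu.1
      have := hu.2.ne
      grind [SimpleGraph.Adj.symm]
    have := Finset.card_le_card h1
    have := hd y hy
    omega
  -- Otherwise the degree of `x` forces its neighbourhood to be `insert a K`, giving a clique on
  -- `K.card + 2` vertices that avoids `y`.
  have hxs : G.Adj x s := by
    by_contra hxs
    have h1 : nbr G X x ⊆ insert a K := by
      intro u hu
      have hu := mem_nbr.1 hu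
      have := hcov u hu.1
      have := hu.2.ne
      simp only [Finset.mem_insert]
      grind [SimpleGraph.Adj.symm]
    have h2 := Finset.eq_of_subset_of_card_le h1 (by rw [hd x hx]; exact Finset.card_insert_le _ _)
    have h3 := card_le_chi (G := G) (X := X.erase y) (Y := insert x (insert a K)) ?_ ?_
    · rw [Finset.card_insert_of_notMem, Finset.card_insert_of_notMem] at h3
      · omega
      · simp [hK']
      · simp only [Finset.mem_insert, hK']
        grind
    · intro u hu
      simp only [Finset.mem_insert, hK', Finset.mem_erase] at *
      grind
    · have : ∀ u ∈ insert a K, G.Adj x u := fun u hu => (mem_nbr.1 (h2 ▸ hu : u ∈ nbr G X x)).2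
      simp only [Finset.mem_insert, hK'] at this ⊢
      simp only [hK'] at hKK
      grind [SimpleGraph.Adj.symm]
  have hxS : ∀ t ∈ S, G.Adj x t → t = s := fun t ht hxt => hSDR t ht s hs hxt hys
  have hyS : ∀ t ∈ S, G.Adj y t → t = s := fun t ht hyt => (hSDR s hs t ht hxs hyt).symm
  have hyK : ∀ k ∈ K, G.Adj y k := by
    have h1 : nbr G X y ⊆ insert s K := by
      intro u hu
      have hu := mem_nbr.1 hu
      have := hcov u hu.1
      have := hu.2.ne
      simp only [Finset.mem_insert]
      grind [SimpleGraph.Adj.symm]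
    have h2 := Finset.eq_of_subset_of_card_le h1 (by rw [hd y hy]; exact Finset.card_insert_le _ _)
    intro k hk
    have : k ∈ nbr G X y := h2 ▸ Finset.mem_insert_of_mem hk
    exact (mem_nbr.1 this).2
  -- `y`, `a` and the rest of `K` already exhaust the degree of `k`.
  have hKn : ∀ k ∈ K, ∀ u ∈ X, G.Adj k u → u = y ∨ u = a ∨ u ∈ K := by
    intro k hk u hu hku
    have h1 : insert y (insert a (K.erase k)) ⊆ nbr G X k := by
      intro w hw
      simp only [Finset.mem_insert, Finset.mem_erase, mem_nbr] at *
      grind [SimpleGraph.Adj.symm]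
    have h2 := Finset.eq_of_subset_of_card_le h1 (by
      rw [hd k ((hK' k).1 hk).1.2.2, Finset.card_insert_of_notMem, Finset.card_insert_of_notMem,
        Finset.card_erase_add_one hk]
      · simp [hK']
      · simp only [Finset.mem_insert, Finset.mem_erase, hK']
        grind)
    have : u ∈ nbr G X k := by simp [hu, hku]
    rw [← h2] at this
    simp only [Finset.mem_insert, Finset.mem_erase] at this
    tauto
  have hK1 : K.card = 1 := by
    have h1 : nbr G X x = {a, s} := by
      ext u
      simp only [mem_nbr, Finset.mem_insert, Finset.mem_singleton]
      constructor
      · intro hu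
        have := hcov u hu.1
        have := hu.2.ne
        grind [SimpleGraph.Adj.symm]
      · rintro (rfl | rfl)
        · exact ⟨ha.2.2, hax.symm⟩
        · exact ⟨((hS' _).1 hs).1.2.2, hxs⟩
    have h2 := hd x hx
    rw [h1, Finset.card_pair ((hS' s).1 hs).2.1] at h2
    omega
  obtain ⟨k, hk⟩ := Finset.card_eq_one.1 hK1
  have hkK : k ∈ K := by simp [hk]
  -- All degrees are now 2, and `t` can only see `x` and `y`; so it sees `x`, whose only neighbour
  -- in `S` is `s`.
  have hS1 : ∀ t ∈ S, t = s := by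
    intro t ht
    have htX := ((hS' t).1 ht).1.2.2
    have h1 : nbr G X t ⊆ {x, y} := by
      intro u hu
      have hu := mem_nbr.1 hu
      have h1 := hcov u hu.1
      have h2 := hu.2.ne
      simp only [Finset.mem_insert, Finset.mem_singleton]
      have h3 := (hS' t).1 ht
      have h4 : u ∉ K := fun h => by
        rcases hKn u h t htX hu.2.symm with h5 | h5 | h5
        · exact h3.1.1 h5
        · exact h3.2.1 h5.symm
        · exact h3.2.2 ((hK' t).1 h5).2
      have h5 : u ∉ S := fun h => hSS t ht u h hu.2
      have h6 : u ≠ a := fun h => h3.2.2 (h ▸ hu.2.symm)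
      rcases h1 with h1 | h1 | h1 | h1 | h1
      · exact absurd h1 h6
      · exact Or.inl h1
      · exact Or.inr h1
      · exact absurd h1 h4
      · exact absurd h1 h5
    have h2 := Finset.eq_of_subset_of_card_le h1 (by
      rw [Finset.card_pair hxy, hd t htX, hK1])
    have : x ∈ nbr G X t := by simp [h2]
    exact hxS t ht (mem_nbr.1 this).2.symm
  have hcov' : ∀ u ∈ X, u = a ∨ u = x ∨ u = s ∨ u = y ∨ u = k := by
    intro u hu
    have h1 := hcov u hu
    have h2 := hS1 u
    rw [hk, Finset.mem_singleton] at h1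
    tauto
  have hkn := hKn k hkK
  have hyk := hyK k hkK
  rw [hk] at hkn
  have hkK := (hK' k).1 hkK
  have hsS := (hS' s).1 hs
  have hkx : ¬ G.Adj k x := fun h => by
    have := hkn x hx h
    simp only [Finset.mem_singleton] at this
    have := hax.ne
    tauto
  have hks : ¬ G.Adj k s := fun h => by
    have := hkn s hsS.1.2.2 h
    simp only [Finset.mem_singleton] at this
    have := h.ne
    tauto
  exact exists_pentagonOn_of_five ha.2.2 hx hsS.1.2.2 hy hkK.1.2.2 hcov' hax hxs hys.symm hyk
    hkK.2.symm hsS.2.2 hay hnxy (fun h => hkx h.symm) (fun h => hks h.symm)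

/-- A vertex of `K` would have degree at least `K.card + 4`, so `K` is empty and all degrees are 3.
A vertex of `S` sees only `x` and `y`, so `S` is empty too. Then `x` and `y` each have three
neighbours among five pentagon vertices; a common one has degree at least 4. -/
theorem PentagonOn.not_regular {f : Fin 5 → V} {x y : V} (hx : x ∈ X) (hy : y ∈ X) (hxy : x ≠ y)
    (hnxy : ¬ G.Adj x y) (h : PentagonOn G ((X.erase x).erase y) f)
    (hd : ∀ v ∈ X, (nbr G X v).card = (joined G ((X.erase x).erase y) f).card + 3) : False := by
  set K := joined G ((X.erase x).erase y) f with hKdef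
  set S := joined Gᶜ ((X.erase x).erase y) f with hSdef
  have hf : ∀ i, f i ≠ y ∧ f i ≠ x ∧ f i ∈ X := by simpa using h.mem
  have hadj := h.adj
  have hinj := h.inj
  have hcov : ∀ u ∈ X, u = x ∨ u = y ∨ (∃ i, f i = u) ∨ u ∈ K ∨ u ∈ S := by
    intro u hu
    by_cases h1 : u = x
    · exact Or.inl h1
    by_cases h2 : u = y
    · exact Or.inr (Or.inl h2)
    exact Or.inr (Or.inr (h.mem_cases (by simp [hu, h1, h2])))
  have hK' : ∀ u, u ∈ K ↔ (u ≠ y ∧ u ≠ x ∧ u ∈ X) ∧ ∀ i, G.Adj (f i) u := by simp [hKdef]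
  have hS' : ∀ u, u ∈ S ↔ (u ≠ y ∧ u ≠ x ∧ u ∈ X) ∧ ∀ i, f i ≠ u ∧ ¬ G.Adj (f i) u := by
    simp [hSdef]
  have hcf : (Finset.univ.image f).card = 5 := by
    rw [Finset.card_image_of_injective _ hinj]; rfl
  have hKe : K = ∅ := by
    by_contra hne
    obtain ⟨k, hk⟩ := Finset.nonempty_iff_ne_empty.2 hne
    have hk' := (hK' k).1 hk
    have h1 : Finset.univ.image f ∪ K.erase k ⊆ nbr G X k := by
      intro u hu
      simp only [Finset.mem_union, Finset.mem_image, Finset.mem_univ, true_and,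
        Finset.mem_erase] at hu
      rw [mem_nbr]
      rcases hu with ⟨i, rfl⟩ | ⟨h1, h2⟩
      · exact ⟨(hf i).2.2, (hk'.2 i).symm⟩
      · have h3 := (hK' u).1 h2
        exact ⟨h3.1.2.2, h.clique k (by simpa using hk'.1) u (by simpa using h3.1) hk'.2 h3.2
          (Ne.symm h1)⟩
    have h2 := Finset.card_le_card h1
    rw [Finset.card_union_of_disjoint, hcf, hd k hk'.1.2.2, Finset.card_erase_of_mem hk] at h2
    · omega
    · rw [Finset.disjoint_left]
      intro u hu hu'
      obtain ⟨i, -, rfl⟩ := Finset.mem_image.1 hu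
      exact (((hK' _).1 (Finset.mem_of_mem_erase hu')).2 i).ne rfl
  rw [hKe] at hd hcov
  simp only [Finset.card_empty, zero_add, Finset.notMem_empty, false_or] at hd hcov
  have hSe : S = ∅ := by
    by_contra hne
    obtain ⟨s, hs⟩ := Finset.nonempty_iff_ne_empty.2 hne
    have hs' := (hS' s).1 hs
    have h1 : nbr G X s ⊆ {x, y} := by
      intro u hu
      have hu := mem_nbr.1 hu
      simp only [Finset.mem_insert, Finset.mem_singleton]
      rcases hcov u hu.1 with h1 | h1 | ⟨i, rfl⟩ | h1
      · exact Or.inl h1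
      · exact Or.inr h1
      · exact absurd hu.2.symm (hs'.2 i).2
      · have h3 := (hS' u).1 h1
        exact absurd hu.2 (h.indep s (by simpa using hs'.1) u (by simpa using h3.1)
          (fun i => (hs'.2 i).2) (fun i => (h3.2 i).2))
    have h2 := Finset.card_le_card h1
    rw [hd s hs'.1.2.2, Finset.card_pair hxy] at h2
    omega
  rw [hSe] at hcov
  simp only [Finset.notMem_empty, or_false] at hcov
  have h1 : nbr G X x ∪ nbr G X y ⊆ Finset.univ.image f := by
    intro u hu
    simp only [Finset.mem_union, mem_nbr] at hu
    simp only [Finset.mem_image, Finset.mem_univ, true_and]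
    rcases hu with hu | hu
    · rcases hcov u hu.1 with rfl | rfl | h
      · exact absurd rfl hu.2.ne
      · exact absurd hu.2 hnxy
      · exact h
    · rcases hcov u hu.1 with rfl | rfl | h
      · exact absurd hu.2.symm hnxy
      · exact absurd rfl hu.2.ne
      · exact h
  have h2 := Finset.card_le_card h1
  rw [Finset.card_union_of_disjoint, hd x hx, hd y hy, hcf] at h2
  · omega
  · rw [Finset.disjoint_left]
    intro u hu hu'
    obtain ⟨i, -, rfl⟩ := Finset.mem_image.1 (h1 (Finset.mem_union_left _ hu))
    have hfin : ∀ i : Fin 5, i = i + 4 + 1 ∧ i + 1 ≠ i + 4 := by decide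
    have h3 : {x, y, f (i + 1), f (i + 4)} ⊆ nbr G X (f i) := by
      intro w hw
      simp only [Finset.mem_insert, Finset.mem_singleton] at hw
      rw [mem_nbr]
      rcases hw with rfl | rfl | rfl | rfl
      · exact ⟨hx, (mem_nbr.1 hu).2.symm⟩
      · exact ⟨hy, (mem_nbr.1 hu').2.symm⟩
      · exact ⟨(hf _).2.2, (hadj _ _).2 (Or.inl rfl)⟩
      · exact ⟨(hf _).2.2, (hadj _ _).2 (Or.inr (hfin i).1)⟩
    have h4 := Finset.card_le_card h3
    rw [hd _ (hf i).2.2, Finset.card_insert_of_notMem, Finset.card_insert_of_notMem,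
      Finset.card_pair] at h4
    · omega
    · exact hinj.ne (hfin i).2
    · simp only [Finset.mem_insert, Finset.mem_singleton, not_or]
      exact ⟨(hf _).1.symm, (hf _).1.symm⟩
    · simp only [Finset.mem_insert, Finset.mem_singleton, not_or]
      exact ⟨hxy, (hf _).2.1.symm, (hf _).2.1.symm⟩

theorem exists_extend_pair {x y : V} (hx : x ∈ X) (hy : y ∈ X) (hxy : x ≠ y) (hnxy : ¬ G.Adj x y)
    (h : (∃ a, SwingOn G ((X.erase x).erase y) a) ∨ ∃ f, PentagonOn G ((X.erase x).erase y) f)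
    (hNG : chi G X + chi Gᶜ X = X.card + 1)
    (hd : ∀ v ∈ X, (nbr G X v).card + 1 = chi G X)
    (hcr : ∀ v ∈ X, chi G (X.erase v) < chi G X)
    (h1 : chi G X ≤ chi G ((X.erase x).erase y) + 1)
    (h2 : chi Gᶜ X ≤ chi Gᶜ ((X.erase x).erase y) + 1) :
    ∃ f, PentagonOn G X f := by
  have hcx : (X.erase x).card + 1 = X.card := Finset.card_erase_add_one hx
  have hcy : ((X.erase x).erase y).card + 1 = (X.erase x).card :=
    Finset.card_erase_add_one (by simp [hy, hxy.symm])
  rcases h with ⟨a, h⟩ | ⟨f, h⟩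
  · have h3 := h.chi_le
    have h4 := h.compl.chi_le
    have h5 := card_nbr_add_card_nbr_compl (G := G) h.mem
    have hp : chi G X = (nbr G ((X.erase x).erase y) a).card + 2 := by omega
    have hq : chi Gᶜ X = (nbr Gᶜ ((X.erase x).erase y) a).card + 2 := by omega
    have haX : a ∈ X := Finset.mem_of_mem_erase (Finset.mem_of_mem_erase h.mem)
    have hd' : ∀ v ∈ X, (nbr G X v).card = (nbr G ((X.erase x).erase y) a).card + 1 := by
      intro v hv
      have := hd v hv
      omega
    have hS : ¬ ColorableOn Gᶜ X ((nbr Gᶜ ((X.erase x).erase y) a).card + 1) := by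
      rw [← chi_le_iff]; omega
    -- The degree of `a` must exceed its degree without `x` and `y` by exactly one, so `a` sees
    -- exactly one of them.
    by_cases hax : G.Adj a x <;> by_cases hay : G.Adj a y
    · exfalso
      have h6 : nbr G X a = insert x (insert y (nbr G ((X.erase x).erase y) a)) := by
        ext u
        simp only [Finset.mem_insert, mem_nbr, Finset.mem_erase]
        grind
      have h7 := hd' a haX
      rw [h6, Finset.card_insert_of_notMem (by simp [hxy]),
        Finset.card_insert_of_notMem (by simp)] at h7
      omega
    · have := hcr y hy
      exact h.exists_pentagon hx hy hxy hnxy hax hay hd' (by omega) hS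
    · have := hcr x hx
      rw [Finset.erase_right_comm] at h hd' hS hp
      exact h.exists_pentagon hy hx hxy.symm (fun h => hnxy h.symm) hay hax hd' (by omega) hS
    · exfalso
      have h6 : nbr G X a = (nbr G ((X.erase x).erase y) a) := by
        ext u
        simp only [mem_nbr, Finset.mem_erase]
        grind
      have h7 := hd' a haX
      rw [h6] at h7
      omega
  · exfalso
    have h3 := h.chi_le
    have h4 := h.compl.chi_le
    rw [joined_two_mul] at h4
    have h5 := h.card_eq
    refine h.not_regular hx hy hxy hnxy fun v hv => ?_
    have := hd v hv
    omega

/-- The structure of the graphs attaining equality in the Nordhaus-Gaddum inequality. -/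
theorem exists_swing_or_pentagon (G : SimpleGraph V) (X : Finset V)
    (hNG : chi G X + chi Gᶜ X = X.card + 1) :
    (∃ a, SwingOn G X a) ∨ ∃ f, PentagonOn G X f := by
  induction hn : X.card using Nat.strong_induction_on generalizing G X with
  | _ n ih =>
  subst hn
  have hcompl : ∀ {Y : Finset V}, ((∃ a, SwingOn Gᶜ Y a) ∨ ∃ f, PentagonOn Gᶜ Y f) →
      ((∃ a, SwingOn G Y a) ∨ ∃ f, PentagonOn G Y f) := by
    rintro Y (⟨a, h⟩ | ⟨f, h⟩)
    · exact Or.inl ⟨a, by simpa using h.compl⟩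
    · exact Or.inr ⟨_, by simpa using h.compl⟩
  have hcard : ∀ v ∈ X, (X.erase v).card + 1 = X.card := fun v hv => Finset.card_erase_add_one hv
  have hle := fun v => chi_le_chi_erase G X v
  have hle' := fun v => chi_le_chi_erase Gᶜ X v
  have hmono := fun v => chi_mono (G := G) (Finset.erase_subset v X)
  have hmono' := fun v => chi_mono (G := Gᶜ) (Finset.erase_subset v X)
  have hub := fun v => chi_add_chi_compl_le G (X.erase v)
  -- If deleting some `v` preserves one chromatic number, equality survives the deletion and the
  -- structure extends back over `v`, passing to the complement if needed. Otherwise every vertex is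
  -- critical in `G` and in `Gᶜ`, and both graphs are regular of degree one less than their
  -- chromatic number.
  by_cases hcr : ∀ v ∈ X, chi G (X.erase v) < chi G X ∧ chi Gᶜ (X.erase v) < chi Gᶜ X
  swap
  · push Not at hcr
    obtain ⟨v, hv, hcr⟩ := hcr
    have h1 := hcard v hv
    have h2 := hle v
    have h3 := hle' v
    have h4 := hmono v
    have h5 := hmono' v
    have h6 := hub v
    by_cases h7 : chi G (X.erase v) < chi G X
    · have h8 := hcr h7
      apply hcompl
      refine exists_extend hv (ih _ (by omega) Gᶜ (X.erase v) ?_ rfl) ?_ ?_ <;>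
        rw [compl_compl] <;> omega
    · exact exists_extend hv (ih _ (by omega) G (X.erase v) (by omega) rfl) (by omega) (by omega)
  have hd : ∀ v ∈ X, (nbr G X v).card + 1 = chi G X ∧ (nbr Gᶜ X v).card + 1 = chi Gᶜ X := by
    intro v hv
    have h1 := card_nbr_add_card_nbr_compl (G := G) hv
    have h2 := hcr v hv
    have h3 : chi G (X.erase v) ≤ (nbr G X v).card := by
      by_contra! h
      have := chi_le_iff.2 ((colorableOn_chi G (X.erase v)).of_erase h)
      omega
    have h4 : chi Gᶜ (X.erase v) ≤ (nbr Gᶜ X v).card := by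
      by_contra! h
      have := chi_le_iff.2 ((colorableOn_chi Gᶜ (X.erase v)).of_erase h)
      omega
    have h5 := hle v
    have h6 := hle' v
    omega
  -- For a nonadjacent pair, `chi G` drops by at most one because the pair is a colour class. If
  -- `chi Gᶜ` does too, equality survives the deletion of the pair; if it never does, `Gᶜ` is
  -- double-critical.
  by_cases hpair : ∃ x ∈ X, ∃ y ∈ X, x ≠ y ∧ ¬ G.Adj x y ∧
      chi Gᶜ X ≤ chi Gᶜ ((X.erase x).erase y) + 1
  · obtain ⟨x, hx, y, hy, hxy, hnxy, h1⟩ := hpair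
    have hcx := hcard x hx
    have hcy : ((X.erase x).erase y).card + 1 = (X.erase x).card :=
      Finset.card_erase_add_one (by simp [hy, hxy.symm])
    have h2 : chi G X ≤ chi G ((X.erase x).erase y) + 1 := by
      refine chi_le_iff.2 ((colorableOn_chi G ((X.erase x).erase y)).add_indep {x, y} ?_ ?_)
      · simp only [Finset.mem_insert, Finset.mem_singleton]
        grind [SimpleGraph.Adj.symm, SimpleGraph.irrefl]
      · intro v hv
        simp only [Finset.mem_insert, Finset.mem_singleton, Finset.mem_erase]
        tauto
    have h3 := chi_add_chi_compl_le G ((X.erase x).erase y)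
    exact Or.inr (exists_extend_pair hx hy hxy hnxy (ih _ (by omega) G _ (by omega) rfl) hNG
      (fun v hv => (hd v hv).1) (fun v hv => (hcr v hv).1) h2 h1)
  push Not at hpair
  left
  have hne : X.Nonempty := by
    rw [Finset.nonempty_iff_ne_empty]
    rintro rfl
    have h1 := chi_le_iff.2 (colorableOn_card G ∅)
    have h2 := chi_le_iff.2 (colorableOn_card Gᶜ ∅)
    simp only [Finset.card_empty] at h1 h2 hNG
    omega
  obtain ⟨a, ha⟩ := hne
  -- The double-critical regular graph `Gᶜ` is complete, so every vertex of `X` is a swing vertex.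
  -- The case `chi Gᶜ X ≤ 1` is separate since `k + 2` colours are needed for the lemma.
  have hstable : ∀ x ∈ X, ∀ y ∈ X, ¬ G.Adj x y := by
    intro x hx y hy hxy
    obtain ⟨k, hk⟩ : ∃ k, chi Gᶜ X = k + 2 ∨ chi Gᶜ X ≤ 1 := ⟨chi Gᶜ X - 2, by omega⟩
    rcases hk with hk | hk
    · refine ((compl_adj _ _ _).1 (isClique_of_doubleCritical (G := Gᶜ) (k := k)
        ?_ ?_ ?_ ?_ hx hy hxy.ne)).2 hxy
      · intro v hv
        have := (hd v hv).2
        omega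
      · rw [← chi_le_iff]; omega
      · intro v hv
        have := (hcr v hv).2
        rw [← chi_le_iff]; omega
      · intro u hu v hv huv
        rw [compl_adj] at huv
        have := hpair u hu v hv huv.1 huv.2
        rw [← chi_le_iff]; omega
    · have h1 := (hcr x hx).2
      obtain ⟨g, hg, -⟩ := chi_le_iff.1 (show chi Gᶜ (X.erase x) ≤ 0 by omega)
      exact absurd (hg y (by simp [hy, hxy.ne'])) (by omega)
  exact ⟨a, ha, fun u hu v hv h => absurd h (hstable a ha u hu),
    fun u hu v hv _ _ => hstable u hu v hv⟩

end Induction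

/-! ### NG-graphs and their part A in terms of swing vertices and pentagons -/

section Characterization

variable {V : Type*} [Fintype V] {G : SimpleGraph V}

theorem isNG_iff_chi :
    IsNG G ↔ chi G Finset.univ + chi Gᶜ Finset.univ = (Finset.univ : Finset V).card + 1 := by
  rw [IsNG, chromaticNumber_eq_chi, chromaticNumber_eq_chi, Finset.card_univ]
  norm_cast

theorem mem_aPart_iff {v : V} :
    v ∈ aPart G ↔ (nbr G Finset.univ v).card + 1 = chi G Finset.univ := by
  classical
  have : nbr G Finset.univ v = G.neighborFinset v := by
    ext u; simp
  rw [this, card_neighborFinset_eq_degree, aPart, chromaticNumber_eq_chi, Set.mem_ofPred_eq]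
  norm_cast

/-- `a` with its neighbours is a clique, in `G` and in `Gᶜ`; the two sizes add up to the
Nordhaus-Gaddum bound, so both lower bounds are sharp. -/
theorem SwingOn.chi_eq {a : V} (h : SwingOn G Finset.univ a) :
    chi G Finset.univ = (nbr G Finset.univ a).card + 1 ∧ IsNG G := by
  classical
  rw [isNG_iff_chi]
  have key : ∀ {H : SimpleGraph V}, SwingOn H Finset.univ a →
      (nbr H Finset.univ a).card + 1 ≤ chi H Finset.univ := by
    intro H h
    rw [← Finset.card_insert_of_notMem (a := a) (by simp)]
    refine card_le_chi (Finset.subset_univ _) fun u hu v hv huv => ?_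
    simp only [Finset.mem_insert, mem_nbr] at hu hv
    rcases hu with rfl | hu <;> rcases hv with rfl | hv
    · exact absurd rfl huv
    · exact hv.2
    · exact hu.2.symm
    · exact h.clique u hu.1 v hv.1 hu.2 hv.2 huv
  have h1 := key h
  have h2 := key h.compl
  have h3 := card_nbr_add_card_nbr_compl (G := G) h.mem
  have h4 := chi_add_chi_compl_le G Finset.univ
  omega

omit [Fintype V] in
theorem three_le_of_pentagon {f : Fin 5 → V} {X : Finset V} (h : PentagonOn G X f) :
    (joined G X f).card + 3 ≤ chi G X := by
  classical
  obtain ⟨c, hc1, hc2⟩ := colorableOn_chi G X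
  have h3 : 3 ≤ (Finset.univ.image fun i => c (f i)).card := by
    by_contra! hlt
    have hmem : ∀ i, c (f i) ∈ Finset.univ.image fun i => c (f i) :=
      fun i => Finset.mem_image_of_mem _ (Finset.mem_univ i)
    have hne : ∀ i, c (f i) ≠ c (f (i + 1)) := fun i =>
      hc2 _ (h.mem _) _ (h.mem _) ((h.adj _ _).2 (Or.inl rfl))
    -- With two colours on the pentagon, vertices at distance two agree; then `f 0`, `f 2`, `f 4`
    -- agree although `f 4` and `f 0` are adjacent.
    have heq : ∀ i, c (f i) = c (f (i + 1 + 1)) := by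
      intro i
      by_contra hne'
      have hsub : {c (f i), c (f (i + 1)), c (f (i + 1 + 1))} ⊆
          Finset.univ.image fun i => c (f i) := by
        intro x hx
        simp only [Finset.mem_insert, Finset.mem_singleton] at hx
        rcases hx with rfl | rfl | rfl <;> exact hmem _
      have := Finset.card_le_card hsub
      rw [Finset.card_insert_of_notMem (by simp [hne, hne']), Finset.card_pair (hne _)] at this
      omega
    exact hne 4 (((heq 0).trans (heq 2)).symm)
  have hsub : (joined G X f).image c ∪ (Finset.univ.image fun i => c (f i)) ⊆
      Finset.range (chi G X) := by
    intro x hx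
    simp only [Finset.mem_union, Finset.mem_image, Finset.mem_univ, true_and, mem_joined,
      Finset.mem_range] at *
    rcases hx with ⟨u, hu, rfl⟩ | ⟨i, rfl⟩
    · exact hc1 u hu.1
    · exact hc1 _ (h.mem i)
  have h4 := Finset.card_le_card hsub
  rw [Finset.card_union_of_disjoint, Finset.card_image_of_injOn, Finset.card_range] at h4
  · omega
  · intro u hu v hv huv
    by_contra hne
    have hu := mem_joined.1 hu
    have hv := mem_joined.1 hv
    exact hc2 u hu.1 v hv.1 (h.clique u hu.1 v hv.1 hu.2 hv.2 hne) huv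
  · rw [Finset.disjoint_left]
    intro x hx hx'
    obtain ⟨u, hu, rfl⟩ := Finset.mem_image.1 hx
    obtain ⟨i, -, hi⟩ := Finset.mem_image.1 hx'
    have hu := mem_joined.1 hu
    exact hc2 _ (h.mem i) u hu.1 (hu.2 i) hi

theorem PentagonOn.chi_eq {f : Fin 5 → V} (h : PentagonOn G Finset.univ f) :
    chi G Finset.univ = (joined G Finset.univ f).card + 3 ∧ IsNG G := by
  classical
  rw [isNG_iff_chi]
  have h1 := three_le_of_pentagon h
  have h2 := three_le_of_pentagon h.compl
  rw [joined_two_mul] at h2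
  have h3 := h.card_eq
  have h4 := chi_add_chi_compl_le G Finset.univ
  omega

theorem isNG_iff :
    IsNG G ↔ (∃ a, SwingOn G Finset.univ a) ∨ ∃ f, PentagonOn G Finset.univ f := by
  classical
  constructor
  · intro h
    exact exists_swing_or_pentagon G _ (isNG_iff_chi.1 h)
  · rintro (⟨a, h⟩ | ⟨f, h⟩)
    · exact h.chi_eq.2
    · exact h.chi_eq.2

/-- Any two swing vertices are twins. -/
theorem SwingOn.adj_iff {a b v : V} (ha : SwingOn G Finset.univ a) (hb : SwingOn G Finset.univ b)
    (hva : v ≠ a) (hvb : v ≠ b) : G.Adj a v ↔ G.Adj b v := by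
  have h1 := ha.clique
  have h2 := ha.indep
  have h3 := hb.clique
  have h4 := hb.indep
  simp only [Finset.mem_univ, true_imp_iff] at h1 h2 h3 h4
  have h5 := h1 b v
  have h6 := h2 b v
  have h7 := h3 a v
  have h8 := h4 a v
  have := G.adj_comm a b
  have := SimpleGraph.irrefl G (v := a)
  have := SimpleGraph.irrefl G (v := b)
  have := hva.symm
  have := hvb.symm
  tauto

theorem SwingOn.of_twins {a b : V} (ha : SwingOn G Finset.univ a)
    (htwin : ∀ v, v ≠ a → v ≠ b → (G.Adj a v ↔ G.Adj b v)) : SwingOn G Finset.univ b := by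
  have h1 := ha.clique
  have h2 := ha.indep
  simp only [Finset.mem_univ, true_imp_iff] at h1 h2
  refine ⟨Finset.mem_univ _, fun u _ v _ hu hv huv => ?_, fun u _ v _ hu hv huv => ?_⟩
  · by_cases hua : u = a
    · subst hua
      exact (htwin v huv.symm hv.ne').2 hv
    by_cases hva : v = a
    · subst hva
      exact ((htwin u huv hu.ne').2 hu).symm
    exact h1 u v ((htwin u hua hu.ne').2 hu) ((htwin v hva hv.ne').2 hv) huv
  · have hub : u ≠ b := by rintro rfl; exact hv huv
    have hvb : v ≠ b := by rintro rfl; exact hu huv.symm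
    by_cases hua : u = a
    · subst hua
      exact hv ((htwin v huv.ne' hvb).1 huv)
    by_cases hva : v = a
    · subst hva
      exact hu ((htwin u huv.ne hub).1 huv.symm)
    exact h2 u v (fun h => hu ((htwin u hua hub).1 h)) (fun h => hv ((htwin v hva hvb).1 h)) huv

/-- A vertex `b` of the same degree as `a` is a twin of `a`: the clique and stability conditions
give one inclusion of (closed or open) neighbourhoods, and equal cardinality makes it an equality.
-/
theorem SwingOn.aPart_eq {a : V} (ha : SwingOn G Finset.univ a) :
    aPart G = {v | SwingOn G Finset.univ v} := by
  classical
  ext b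
  rw [mem_aPart_iff, Set.mem_ofPred_eq]
  constructor
  swap
  · exact fun h => h.chi_eq.1.symm
  rw [ha.chi_eq.1]
  intro hcard
  have h1 := ha.clique
  have h2 := ha.indep
  simp only [Finset.mem_univ, true_imp_iff] at h1 h2
  have htwin : ∀ v, v ≠ a → v ≠ b → (G.Adj a v ↔ G.Adj b v) := by
    by_cases hadj : G.Adj a b
    · have hsub : insert a (nbr G Finset.univ a) ⊆ insert b (nbr G Finset.univ b) := by
        intro u hu
        simp only [Finset.mem_insert, mem_nbr, Finset.mem_univ, true_and] at *
        rcases hu with rfl | hu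
        · exact Or.inr hadj.symm
        · by_cases hub : u = b
          · exact Or.inl hub
          · exact Or.inr (h1 b u hadj hu (Ne.symm hub))
      have heq := Finset.eq_of_subset_of_card_le hsub (by
        rw [Finset.card_insert_of_notMem (by simp), Finset.card_insert_of_notMem (by simp)]; omega)
      intro v hva hvb
      have := Finset.ext_iff.1 heq v
      simpa [hva, hvb] using this
    · have hsub : nbr G Finset.univ b ⊆ nbr G Finset.univ a := by
        intro u hu
        simp only [mem_nbr, Finset.mem_univ, true_and] at *
        by_contra hu'
        exact h2 b u hadj hu' hu
      have heq := Finset.eq_of_subset_of_card_le hsub (by omega)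
      intro v hva hvb
      have := Finset.ext_iff.1 heq v
      simpa using this.symm
  exact ha.of_twins htwin

/-- With `k` joined vertices, the pentagon vertices have degree `k + 2`, the joined ones at least `k
+ 4`, and the stable ones at most `k`. -/
theorem PentagonOn.aPart_eq {f : Fin 5 → V} (h : PentagonOn G Finset.univ f) :
    aPart G = Set.range f := by
  classical
  have hcf : (Finset.univ.image f).card = 5 := by
    rw [Finset.card_image_of_injective _ h.inj]; rfl
  ext v
  rw [mem_aPart_iff, h.chi_eq.1]
  rcases h.mem_cases (Finset.mem_univ v) with ⟨i, rfl⟩ | hv | hv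
  · refine iff_of_true ?_ ⟨i, rfl⟩
    have h1 : nbr G Finset.univ (f i) = {f (i + 1), f (i + 4)} ∪ joined G Finset.univ f := by
      ext u
      simp only [mem_nbr, Finset.mem_univ, true_and, Finset.mem_union, Finset.mem_insert,
        Finset.mem_singleton, mem_joined]
      rcases h.mem_cases (Finset.mem_univ u) with ⟨j, rfl⟩ | hu | hu
      · have h2 : ¬ ∀ i, G.Adj (f i) (f j) := fun h => (h j).ne rfl
        rw [h.adj, h.inj.eq_iff, h.inj.eq_iff]
        have h3 : ∀ i j : Fin 5, i = j + 1 ↔ j = i + 4 := by decide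
        rw [← h3]
        tauto
      · have hu := (mem_joined.1 hu).2
        exact iff_of_true (hu i) (Or.inr hu)
      · have hu := (mem_joined.1 hu).2
        simp only [compl_adj] at hu
        refine iff_of_false (hu i).2 ?_
        have := (hu (i + 1)).1
        have := (hu (i + 4)).1
        have := hu i
        rintro ((h | h) | h)
        · tauto
        · tauto
        · exact (hu 0).2 (h 0)
    rw [h1, Finset.card_union_of_disjoint, Finset.card_pair]
    · omega
    · rw [h.inj.ne_iff]
      have h3 : ∀ i : Fin 5, i + 1 ≠ i + 4 := by decide
      exact h3 i
    · rw [Finset.disjoint_left]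
      intro u hu hu'
      simp only [Finset.mem_insert, Finset.mem_singleton] at hu
      have hu' := (mem_joined.1 hu').2
      rcases hu with rfl | rfl
      · exact (hu' (i + 1)).ne rfl
      · exact (hu' (i + 4)).ne rfl
  · have hv' := (mem_joined.1 hv).2
    refine iff_of_false ?_ (by rintro ⟨i, rfl⟩; exact (hv' i).ne rfl)
    have hsub : (joined G Finset.univ f).erase v ∪ Finset.univ.image f ⊆
        nbr G Finset.univ v := by
      intro u hu
      simp only [Finset.mem_union, Finset.mem_erase, Finset.mem_image, Finset.mem_univ,
        true_and, mem_nbr, mem_joined] at *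
      rcases hu with hu | ⟨i, rfl⟩
      · exact h.clique v (Finset.mem_univ _) u (Finset.mem_univ _) hv' hu.2 (Ne.symm hu.1)
      · exact (hv' i).symm
    have h4 := Finset.card_le_card hsub
    rw [Finset.card_union_of_disjoint, hcf, Finset.card_erase_of_mem hv] at h4
    · omega
    · rw [Finset.disjoint_left]
      intro u hu hu'
      obtain ⟨i, -, rfl⟩ := Finset.mem_image.1 hu'
      exact ((mem_joined.1 (Finset.mem_of_mem_erase hu)).2 i).ne rfl
  · have hv' := (mem_joined.1 hv).2
    simp only [compl_adj] at hv'
    refine iff_of_false ?_ (by rintro ⟨i, rfl⟩; exact (hv' i).1 rfl)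
    have hsub : nbr G Finset.univ v ⊆ joined G Finset.univ f := by
      intro u hu
      simp only [mem_nbr, Finset.mem_univ, true_and] at hu
      rcases h.mem_cases (Finset.mem_univ u) with ⟨j, rfl⟩ | hu' | hu'
      · exact absurd hu.symm (hv' j).2
      · exact hu'
      · have hu' := (mem_joined.1 hu').2
        simp only [compl_adj] at hu'
        exact absurd hu (h.indep v (Finset.mem_univ _) u (Finset.mem_univ _)
          (fun i => (hv' i).2) (fun i => (hu' i).2))
    have h4 := Finset.card_le_card hsub
    omega

/-- Swing vertices are pairwise twins, so one adjacency among them propagates to all pairs. -/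
theorem SwingOn.isClique_or_isIndepSet {a : V} (ha : SwingOn G Finset.univ a) :
    G.IsClique (aPart G) ∨ G.IsIndepSet (aPart G) := by
  rw [ha.aPart_eq]
  by_contra! hcon
  simp only [IsClique, IsIndepSet, Set.Pairwise, Set.mem_ofPred_eq] at hcon
  push Not at hcon
  obtain ⟨⟨b, hb, c, hc, hbc, hnbc⟩, ⟨d, hd, e, he, hde, hnde⟩⟩ := hcon
  have key : ∀ {x y z : V}, SwingOn G Finset.univ x → SwingOn G Finset.univ y →
      SwingOn G Finset.univ z → x ≠ z → y ≠ z → (G.Adj x z ↔ G.Adj y z) :=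
    fun hx hy hz h1 h2 => hx.adj_iff hy h1.symm h2.symm
  have h1 := @key d b c hd hb hc
  have h2 := @key d c b hd hc hb
  have h3 := @key e d b he hd hb
  have h4 := @key e d c he hd hc
  have h5 := @key e b d he hb hd
  have := G.adj_comm
  grind

theorem cycleGraph_five_adj (i j : Fin 5) : (cycleGraph 5).Adj i j ↔ (j = i + 1 ∨ i = j + 1) := by
  revert i j
  decide

theorem isNG3_iff : IsNG3 G ↔ ∃ f, PentagonOn G Finset.univ f := by
  constructor
  · rintro ⟨h, ⟨e⟩⟩
    rcases isNG_iff.1 h with ⟨a, ha⟩ | h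
    · exfalso
      have key : ∀ i j, G.Adj (e.symm i) (e.symm j) ↔ (j = i + 1 ∨ i = j + 1) := by
        intro i j
        rw [← cycleGraph_five_adj, ← e.symm.map_adj_iff]
        rfl
      have hne : ∀ i j : Fin 5, i ≠ j → (e.symm i : V) ≠ e.symm j :=
        fun i j hij h => hij (e.symm.injective (Subtype.ext h))
      rcases ha.isClique_or_isIndepSet with h1 | h1
      · have := (key 0 2).1 (h1 (e.symm 0).2 (e.symm 2).2 (hne _ _ (by decide)))
        revert this; decide
      · exact (h1 (e.symm 0).2 (e.symm 1).2 (hne _ _ (by decide))) ((key 0 1).2 (by decide))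
    · exact h
  · rintro ⟨f, h⟩
    refine ⟨h.chi_eq.2, ?_⟩
    rw [h.aPart_eq]
    refine ⟨RelIso.symm ⟨Equiv.ofInjective f h.inj, ?_⟩⟩
    intro i j
    rw [cycleGraph_five_adj, ← h.adj]
    rfl

theorem PentagonOn.not_swing {f : Fin 5 → V} (h : PentagonOn G Finset.univ f) (a : V) :
    ¬ SwingOn G Finset.univ a := by
  intro ha
  have hne : ∀ i j : Fin 5, i ≠ j → f i ≠ f j := fun i j hij => h.inj.ne hij
  have := ha.isClique_or_isIndepSet
  rw [h.aPart_eq] at this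
  rcases this with h1 | h1
  · have := (h.adj 0 2).1 (h1 ⟨0, rfl⟩ ⟨2, rfl⟩ (hne _ _ (by decide)))
    revert this; decide
  · exact h1 ⟨0, rfl⟩ ⟨1, rfl⟩ (hne _ _ (by decide)) ((h.adj 0 1).2 (by decide))

theorem isNG_compl : IsNG Gᶜ ↔ IsNG G := by
  rw [isNG_iff_chi, isNG_iff_chi, compl_compl, add_comm]

theorem IsNG.aPart_compl (h : IsNG G) : aPart Gᶜ = aPart G := by
  classical
  ext v
  rw [mem_aPart_iff, mem_aPart_iff]
  rw [isNG_iff_chi] at h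
  have := card_nbr_add_card_nbr_compl (G := G) (Finset.mem_univ v)
  omega

theorem isNG1_compl : IsNG1 Gᶜ ↔ IsNG2 G := by
  rw [IsNG1, IsNG2, isNG_compl]
  refine and_congr_right fun h => ?_
  rw [h.aPart_compl, isClique_compl]

theorem isNG1_iff : IsNG1 G ↔ (∃ a, SwingOn G Finset.univ a) ∧
    ∀ a b, SwingOn G Finset.univ a → SwingOn G Finset.univ b → a ≠ b → G.Adj a b := by
  constructor
  · rintro ⟨h, hc⟩
    rcases isNG_iff.1 h with ⟨a, ha⟩ | ⟨f, hf⟩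
    · refine ⟨⟨a, ha⟩, fun b c hb hc' hbc => ?_⟩
      rw [ha.aPart_eq] at hc
      exact hc hb hc' hbc
    · exfalso
      rw [hf.aPart_eq] at hc
      have := (hf.adj 0 2).1 (hc ⟨0, rfl⟩ ⟨2, rfl⟩ (hf.inj.ne (by decide)))
      revert this; decide
  · rintro ⟨⟨a, ha⟩, h⟩
    refine ⟨ha.chi_eq.2, ?_⟩
    rw [ha.aPart_eq]
    exact fun b hb c hc hbc => h b c hb hc hbc

end Characterization

/-! ### Unbalanced split graphs are the graphs with a swing vertex -/

section Split

variable {V : Type*} {G : SimpleGraph V}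

/-- `K` is a clique whose complement is stable. -/
structure KS (G : SimpleGraph V) (K : Set V) : Prop where
  clique : ∀ u ∈ K, ∀ v ∈ K, u ≠ v → G.Adj u v
  indep : ∀ u ∉ K, ∀ v ∉ K, ¬ G.Adj u v

theorem IsKSPartition.ks {K S : Finset V} (h : IsKSPartition G K S) : KS G (K : Set V) := by
  obtain ⟨-, h2, h3, h4⟩ := h
  refine ⟨fun u hu v hv huv => h3 hu hv huv, fun u hu v hv huv => ?_⟩
  exact h4 ((h2 u).resolve_left hu) ((h2 v).resolve_left hv) huv.ne huv

theorem isSplit_iff [Finite V] : IsSplit G ↔ ∃ K, KS G K := by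
  classical
  have := Fintype.ofFinite V
  constructor
  · rintro ⟨K, S, h⟩
    exact ⟨K, h.ks⟩
  · rintro ⟨K, h⟩
    refine ⟨Finset.univ.filter (· ∈ K), Finset.univ.filter (· ∉ K), ?_, ?_, ?_, ?_⟩
    · exact Finset.disjoint_filter_filter_not _ _ _
    · intro v
      simp [em]
    · intro u hu v hv huv
      exact h.clique u (by simpa using hu) v (by simpa using hv) huv
    · intro u hu v hv _
      exact h.indep u (by simpa using hu) v (by simpa using hv)

theorem IsKSPartition.compl {K S : Finset V} (h : IsKSPartition G K S) :
    IsKSPartition Gᶜ S K := by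
  obtain ⟨h1, h2, h3, h4⟩ := h
  exact ⟨h1.symm, fun v => (h2 v).symm, by simpa using h4, by simpa using h3⟩

variable [Fintype V]

theorem SwingOn.isClique [DecidableEq V] {a : V} (h : SwingOn G Finset.univ a) :
    G.IsClique (insert a (nbr G Finset.univ a) : Finset V) := by
  intro u hu v hv huv
  simp only [Finset.coe_insert, Set.mem_insert_iff, Finset.mem_coe, mem_nbr] at hu hv
  rcases hu with rfl | hu <;> rcases hv with rfl | hv
  · exact absurd rfl huv
  · exact hv.2
  · exact hu.2.symm
  · exact h.clique u hu.1 v hv.1 hu.2 hv.2 huv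

/-- A clique larger than `K` consists of `K` and one vertex `s` of the stable side; then `K` is the
neighbourhood of `s`, and `s` is a swing vertex. -/
theorem IsKSPartition.card_le_or {K S Q : Finset V} (h : IsKSPartition G K S)
    (hQ : G.IsClique (Q : Set V)) : Q.card ≤ K.card ∨ ∃ a, SwingOn G Finset.univ a := by
  classical
  by_contra! hcon
  obtain ⟨hlt, hno⟩ := hcon
  obtain ⟨s, hsQ, hsK⟩ : ∃ s ∈ Q, s ∉ K := by
    by_contra! hsub
    exact absurd (Finset.card_le_card hsub) (by omega)
  have hks := h.ks
  have hsub : Q.erase s ⊆ K := by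
    intro u hu
    rw [Finset.mem_erase] at hu
    by_contra huK
    exact hks.indep u huK s hsK (hQ hu.2 hsQ hu.1)
  have heq := Finset.eq_of_subset_of_card_le hsub (by rw [Finset.card_erase_of_mem hsQ]; omega)
  have hs : ∀ u, G.Adj s u ↔ u ∈ K := by
    intro u
    constructor
    · intro hsu
      by_contra huK
      exact hks.indep s hsK u huK hsu
    · intro hu
      rw [← heq, Finset.mem_erase] at hu
      exact hQ hsQ hu.2 hu.1.symm
  refine hno s ⟨Finset.mem_univ _, fun u _ v _ hu hv huv => ?_, fun u _ v _ hu hv => ?_⟩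
  · rw [hs] at hu hv
    exact hks.clique u hu v hv huv
  · rw [hs] at hu hv
    exact hks.indep u hu v hv

theorem SwingOn.ks {a : V} (h : SwingOn G Finset.univ a) : KS G {v | G.Adj a v} :=
  ⟨fun u hu v hv huv => h.clique u (Finset.mem_univ u) v (Finset.mem_univ v) hu hv huv,
    fun u hu v hv => h.indep u (Finset.mem_univ u) v (Finset.mem_univ v) hu hv⟩

theorem isUnbalanced_iff : IsUnbalanced G ↔ ∃ a, SwingOn G Finset.univ a := by
  classical
  constructor
  · rintro ⟨⟨K, S, h⟩, hb⟩
    by_contra hno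
    obtain ⟨Q, hQ⟩ := G.exists_isNClique_cliqueNum
    obtain ⟨R, hR⟩ := G.exists_isNIndepSet_indepNum
    refine hb ⟨K, S, h, le_antisymm (IsClique.card_le_cliqueNum (tc := h.2.2.1)) ?_,
      le_antisymm (IsIndepSet.card_le_indepNum (tc := h.2.2.2)) ?_⟩
    · rw [← hQ.card_eq]
      exact (h.card_le_or hQ.isClique).resolve_right hno
    · rw [← hR.card_eq]
      refine (h.compl.card_le_or (by simpa using hR.isIndepSet)).resolve_right ?_
      rintro ⟨a, ha⟩
      exact hno ⟨a, by simpa using ha.compl⟩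
  · rintro ⟨a, ha⟩
    refine ⟨isSplit_iff.2 ⟨_, ha.ks⟩, ?_⟩
    rintro ⟨K, S, h, hK, hS⟩
    have h1 := IsClique.card_le_cliqueNum (tc := ha.isClique)
    have h2 := IsClique.card_le_cliqueNum (tc := ha.compl.isClique)
    rw [cliqueNum_compl, Finset.card_insert_of_notMem (by simp)] at h2
    rw [Finset.card_insert_of_notMem (by simp)] at h1
    have h3 := card_nbr_add_card_nbr_compl (G := G) ha.mem
    have h4 : K.card + S.card ≤ (Finset.univ : Finset V).card := by
      rw [← Finset.card_union_of_disjoint h.1]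
      exact Finset.card_le_card (Finset.subset_univ _)
    omega

end Split

/-! ### Pseudo-split graphs are split or of pentagon type -/

section PseudoSplit

variable {V : Type*} {G : SimpleGraph V}

theorem cycleGraph_four_isIndContained_iff : (cycleGraph 4).IsIndContained G ↔
    ∃ a b c d, G.Adj a b ∧ G.Adj b c ∧ G.Adj c d ∧ G.Adj d a ∧ Gᶜ.Adj a c ∧ Gᶜ.Adj b d := by
  constructor
  · rintro ⟨f⟩
    have key : ∀ i j, i ≠ j → ¬ (cycleGraph 4).Adj i j → Gᶜ.Adj (f i) (f j) := fun i j h1 h2 =>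
      (compl_adj _ _ _).2 ⟨f.injective.ne h1, fun h => h2 (f.map_adj_iff.1 h)⟩
    exact ⟨f 0, f 1, f 2, f 3, f.map_adj_iff.2 (by decide), f.map_adj_iff.2 (by decide),
      f.map_adj_iff.2 (by decide), f.map_adj_iff.2 (by decide),
      key _ _ (by decide) (by decide), key _ _ (by decide) (by decide)⟩
  · rintro ⟨a, b, c, d, hab, hbc, hcd, hda, ⟨hac, hac'⟩, ⟨hbd, hbd'⟩⟩
    have h1 := hab.symm
    have h2 := hbc.symm
    have h3 := hcd.symm
    have h4 := hda.symm
    have h5 : ¬ G.Adj c a := fun h => hac' h.symm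
    have h6 : ¬ G.Adj d b := fun h => hbd' h.symm
    refine ⟨⟨⟨![a, b, c, d], ?_⟩, ?_⟩⟩
    · intro i j
      fin_cases i <;> fin_cases j <;> intro h <;>
        first
        | rfl
        | exact absurd h (by assumption)
        | exact absurd h.symm (by assumption)
        | exact absurd h (G.ne_of_adj (by assumption))
    · intro i j
      fin_cases i <;> fin_cases j <;>
      first
      | exact iff_of_true (by assumption) (by decide)
      | exact iff_of_false (by assumption) (by decide)
      | exact iff_of_false (SimpleGraph.irrefl G) (by decide)

theorem two_edges_isIndContained_iff :
    ((⊤ : SimpleGraph (Fin 2)) ⊕g (⊤ : SimpleGraph (Fin 2))).IsIndContained G ↔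
    ∃ a b c d, G.Adj a b ∧ G.Adj c d ∧ ¬ G.Adj a c ∧ ¬ G.Adj a d ∧ ¬ G.Adj b c ∧
      ¬ G.Adj b d := by
  constructor
  · rintro ⟨f⟩
    refine ⟨f (Sum.inl 0), f (Sum.inl 1), f (Sum.inr 0), f (Sum.inr 1), ?_⟩
    simp [f.map_adj_iff]
  · rintro ⟨a, b, c, d, hab, hcd, hac, had, hbc, hbd⟩
    have hnac : a ≠ c := fun h => had (h ▸ hcd)
    have hnad : a ≠ d := fun h => hac (h ▸ hcd.symm)
    have hnbc : b ≠ c := fun h => hbd (h ▸ hcd)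
    have hnbd : b ≠ d := fun h => hbc (h ▸ hcd.symm)
    have h1 := hab.symm
    have h2 := hcd.symm
    have h3 : ¬ G.Adj c a := fun h => hac h.symm
    have h4 : ¬ G.Adj c b := fun h => hbc h.symm
    have h5 : ¬ G.Adj d a := fun h => had h.symm
    have h6 : ¬ G.Adj d b := fun h => hbd h.symm
    refine ⟨⟨⟨Sum.elim ![a, b] ![c, d], ?_⟩, ?_⟩⟩
    · rintro (i | i) (j | j) <;> fin_cases i <;> fin_cases j <;> intro h <;>
        first
        | rfl
        | exact absurd h (by assumption)
        | exact absurd h.symm (by assumption)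
        | exact absurd h (G.ne_of_adj (by assumption))
    · rintro (i | i) (j | j) <;> fin_cases i <;> fin_cases j <;>
      first
      | exact iff_of_true (by assumption) (by simp)
      | exact iff_of_false (by assumption) (by simp)
      | exact iff_of_false (SimpleGraph.irrefl G) (by simp)

theorem cycleGraph_four_isIndContained_iff_compl : (cycleGraph 4).IsIndContained G ↔
    ((⊤ : SimpleGraph (Fin 2)) ⊕g (⊤ : SimpleGraph (Fin 2))).IsIndContained Gᶜ := by
  rw [cycleGraph_four_isIndContained_iff, two_edges_isIndContained_iff]
  constructor
  · rintro ⟨a, b, c, d, hab, hbc, hcd, hda, hac, hbd⟩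
    exact ⟨a, c, b, d, hac, hbd, fun h => h.2 hab, fun h => h.2 hda.symm, fun h => h.2 hbc.symm,
      fun h => h.2 hcd⟩
  · rintro ⟨a, c, b, d, hac, hbd, hab, had, hcb, hcd⟩
    have key : ∀ {x y : V}, x ≠ y → ¬ Gᶜ.Adj x y → G.Adj x y := fun h1 h2 => by
      by_contra h3
      exact h2 ((compl_adj _ _ _).2 ⟨h1, h3⟩)
    have hnab : a ≠ b := by rintro rfl; exact had hbd
    have hncb : c ≠ b := by rintro rfl; exact hcd hbd
    have hncd : c ≠ d := by rintro rfl; exact hcb hbd.symm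
    have hnad : a ≠ d := by rintro rfl; exact hab hbd.symm
    exact ⟨a, b, c, d, key hnab hab, (key hncb hcb).symm, key hncd hcd, (key hnad had).symm,
      hac, hbd⟩

theorem KS.compl {K : Set V} (h : KS G K) : KS Gᶜ Kᶜ := by
  refine ⟨fun u hu v hv huv => (compl_adj _ _ _).2 ⟨huv, h.indep u hu v hv⟩, ?_⟩
  intro u hu v hv huv
  rw [Set.notMem_compl_iff] at hu hv
  exact huv.2 (h.clique u hu v hv huv.1)

theorem KS.not_two_edges {K : Set V} (h : KS G K) :
    ¬ ((⊤ : SimpleGraph (Fin 2)) ⊕g (⊤ : SimpleGraph (Fin 2))).IsIndContained G := by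
  rw [two_edges_isIndContained_iff]
  rintro ⟨a, b, c, d, hab, hcd, hac, had, hbc, hbd⟩
  have hnac : a ≠ c := fun h => had (h ▸ hcd)
  have hnad : a ≠ d := fun h => hac (h ▸ hcd.symm)
  have hnbc : b ≠ c := fun h => hbd (h ▸ hcd)
  have hnbd : b ≠ d := fun h => hbc (h ▸ hcd.symm)
  have key : ∀ {x y}, x ≠ y → ¬ G.Adj x y → ¬ (x ∈ K ∧ y ∈ K) := fun h1 h2 h3 =>
    h2 (h.clique _ h3.1 _ h3.2 h1)
  have key' : ∀ {x y}, G.Adj x y → x ∈ K ∨ y ∈ K := fun h1 => by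
    by_contra! hcon
    exact h.indep _ hcon.1 _ hcon.2 h1
  have h1 := key hnac hac
  have h2 := key hnad had
  have h3 := key hnbc hbc
  have h4 := key hnbd hbd
  have h5 := key' hab
  have h6 := key' hcd
  tauto

theorem KS.isPseudoSplit {K : Set V} (h : KS G K) : IsPseudoSplit G :=
  ⟨fun hc => h.compl.not_two_edges (cycleGraph_four_isIndContained_iff_compl.1 hc),
    h.not_two_edges⟩

theorem KS.not_pentagon {K : Set V} (h : KS G K) {X : Finset V} (f : Fin 5 → V) :
    ¬ PentagonOn G X f := by
  classical
  intro hf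
  -- No subset of the 5-cycle meets every edge without containing two nonadjacent vertices.
  have key : ∀ N : Fin 5 → Bool, ¬ ((∀ i, N i ∨ N (i + 1)) ∧ ∀ i, ¬ (N i ∧ N (i + 2))) := by
    decide
  refine key (fun i => decide (f i ∈ K)) ⟨fun i => ?_, fun i => ?_⟩ <;>
    simp only [decide_eq_true_eq]
  · by_contra! hcon
    exact h.indep _ hcon.1 _ hcon.2 ((hf.adj _ _).2 (Or.inl rfl))
  · rintro ⟨h1, h2⟩
    have h3 : ∀ i : Fin 5, i ≠ i + 2 ∧ ¬ (i + 2 = i + 1 ∨ i = i + 2 + 1) := by decide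
    exact (h3 i).2 ((hf.adj _ _).1 (h.clique _ h1 _ h2 (hf.inj.ne (h3 i).1)))

theorem PentagonOn.not_two_edges [Fintype V] {f : Fin 5 → V} (h : PentagonOn G Finset.univ f) :
    ¬ ((⊤ : SimpleGraph (Fin 2)) ⊕g (⊤ : SimpleGraph (Fin 2))).IsIndContained G := by
  rw [two_edges_isIndContained_iff]
  have hcases : ∀ v, (∃ i, f i = v) ∨ (∀ i, G.Adj (f i) v) ∨ ∀ i, ¬ G.Adj (f i) v := by
    intro v
    rcases h.mem_cases (Finset.mem_univ v) with hv | hv | hv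
    · exact Or.inl hv
    · exact Or.inr (Or.inl (mem_joined.1 hv).2)
    · exact Or.inr (Or.inr fun i hi => ((mem_joined.1 hv).2 i).2 hi)
  have hclique := fun u v => h.clique u (Finset.mem_univ u) v (Finset.mem_univ v)
  have hindep := fun u v => h.indep u (Finset.mem_univ u) v (Finset.mem_univ v)
  -- All non-neighbours of a joined vertex lie in the stable part, so they span no edge. Hence an
  -- induced `2K₂` would lie inside the pentagon.
  have key1 : ∀ a c d, (∀ i, G.Adj (f i) a) → G.Adj c d → a ≠ c → a ≠ d → ¬ G.Adj a c →
      ¬ G.Adj a d → False := by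
    intro a c d ha hcd hac had hnac hnad
    have hS : ∀ v, a ≠ v → ¬ G.Adj a v → ∀ i, ¬ G.Adj (f i) v := by
      intro v hav hnav
      rcases hcases v with ⟨i, rfl⟩ | hv | hv
      · exact absurd (ha i).symm hnav
      · exact absurd (hclique a v ha hv hav) hnav
      · exact hv
    exact hindep c d (hS c hac hnac) (hS d had hnad) hcd
  have key : ∀ a b c d, G.Adj a b → G.Adj c d → ¬ G.Adj a c → ¬ G.Adj a d → ¬ G.Adj b c →
      ¬ G.Adj b d → ∃ i, f i = a := by
    intro a b c d hab hcd hac had hbc hbd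
    have hnac : a ≠ c := fun h => had (h ▸ hcd)
    have hnad : a ≠ d := fun h => hac (h ▸ hcd.symm)
    have hnbc : b ≠ c := fun h => hbd (h ▸ hcd)
    have hnbd : b ≠ d := fun h => hbc (h ▸ hcd.symm)
    rcases hcases a with ha | ha | ha
    · exact ha
    · exact (key1 a c d ha hcd hnac hnad hac had).elim
    · rcases hcases b with ⟨i, rfl⟩ | hb | hb
      · exact absurd hab.symm (ha i)
      · exact (key1 b c d hb hcd hnbc hnbd hbc hbd).elim
      · exact absurd hab (hindep a b ha hb)
  rintro ⟨a, b, c, d, hab, hcd, hac, had, hbc, hbd⟩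
  have hs : ∀ {x y}, ¬ G.Adj x y → ¬ G.Adj y x := fun h h' => h h'.symm
  obtain ⟨i, rfl⟩ := key a b c d hab hcd hac had hbc hbd
  obtain ⟨j, rfl⟩ := key b _ c d hab.symm hcd hbc hbd hac had
  obtain ⟨k, rfl⟩ := key c d _ _ hcd hab (hs hac) (hs hbc) (hs had) (hs hbd)
  obtain ⟨l, rfl⟩ := key d _ _ _ hcd.symm hab (hs had) (hs hbd) (hs hac) (hs hbc)
  rw [h.adj] at hab hcd hac had hbc hbd
  -- An edge of the 5-cycle has a single vertex adjacent to neither end.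
  have hfin : ∀ i j k : Fin 5, (j = i + 1 ∨ i = j + 1) → ¬ (k = i + 1 ∨ i = k + 1) →
      ¬ (k = j + 1 ∨ j = k + 1) → k = i + 3 ∧ j = i + 1 ∨ k = i + 2 ∧ j = i + 4 := by decide
  have hfin2 : ∀ i k : Fin 5, ¬ (k = k + 1 ∨ k = k + 1) := by decide
  have h1 := hfin i j k hab hac hbc
  have h2 := hfin i j l hab had hbd
  have h3 : ∀ i : Fin 5, i + 1 ≠ i + 4 := by decide
  have h4 : k = l := by
    rcases h1 with h1 | h1 <;> rcases h2 with h2 | h2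
    · exact h1.1.trans h2.1.symm
    · exact absurd (h1.2.symm.trans h2.2) (h3 i)
    · exact absurd (h2.2.symm.trans h1.2) (h3 i)
    · exact h1.1.trans h2.1.symm
  subst h4
  exact hfin2 i k hcd

theorem PentagonOn.isPseudoSplit [Fintype V] {f : Fin 5 → V} (h : PentagonOn G Finset.univ f) :
    IsPseudoSplit G :=
  ⟨fun hc => h.compl.not_two_edges (cycleGraph_four_isIndContained_iff_compl.1 hc),
    h.not_two_edges⟩

theorem IsPseudoSplit.pentagonOn [Fintype V] {f : Fin 5 → V} (h : IsPseudoSplit G)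
    (hadj : ∀ i j, G.Adj (f i) (f j) ↔ (j = i + 1 ∨ i = j + 1)) :
    PentagonOn G Finset.univ f := by
  classical
  obtain ⟨hC, hE⟩ := h
  rw [cycleGraph_four_isIndContained_iff] at hC
  rw [two_edges_isIndContained_iff] at hE
  push Not at hE hC
  have hinj := injective_of_adj_iff hadj
  have hn : ∀ {i j : Fin 5}, ¬ (j = i + 1 ∨ i = j + 1) → ¬ G.Adj (f i) (f j) :=
    fun h h' => h ((hadj _ _).1 h')
  refine ⟨fun i => Finset.mem_univ _, hinj, hadj, fun v _ hv => ?_, fun u _ v _ hu hv huv => ?_,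
    fun u _ v _ hu hv huv => ?_⟩
  -- `N` is the trace of `v` on the cycle. The first condition excludes the `2K₂` on `v, f i` and `f
  -- (i + 2), f (i + 3)`, the second the `C₄` on `f i, f (i + 1), f (i + 2), v`.
  · have key : ∀ N : Fin 5 → Bool, (∀ i, N i → (N (i + 2) ∨ N (i + 3))) →
        (∀ i, N i → N (i + 2) → N (i + 1)) → (∀ i, N i) ∨ (∀ i, ¬ N i) := by decide
    have h3 : ∀ i : Fin 5, ¬ (i + 2 = i + 1 ∨ i = i + 2 + 1) ∧ ¬ (i + 3 = i + 1 ∨ i = i + 3 + 1) ∧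
      (i + 3 = i + 2 + 1 ∨ i + 2 = i + 3 + 1) ∧ (i + 2 = i + 1 + 1) ∧ i ≠ i + 2 := by decide
    have := key (fun i => decide (G.Adj (f i) v)) ?_ ?_
    · simpa only [decide_eq_true_eq] using this
    · intro i hi
      simp only [decide_eq_true_eq] at *
      by_contra! hcon
      exact hcon.2 (hE (f i) v (f (i + 2)) (f (i + 3)) hi ((hadj _ _).2 (h3 i).2.2.1)
        (hn (h3 i).1) (hn (h3 i).2.1) (fun h => hcon.1 h.symm)).symm
    · intro i hi hi2
      simp only [decide_eq_true_eq] at *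
      by_contra hcon
      exact hC (f i) (f (i + 1)) (f (i + 2)) v ((hadj _ _).2 (Or.inl rfl))
        ((hadj _ _).2 (Or.inl (h3 i).2.2.2.1)) hi2 hi.symm
        ((compl_adj _ _ _).2 ⟨hinj.ne (h3 i).2.2.2.2, hn (h3 i).1⟩)
        ((compl_adj _ _ _).2 ⟨hv _, hcon⟩)
  · by_contra hnuv
    exact hC u (f 0) v (f 2) (hu 0).symm (hv 0) (hv 2).symm (hu 2)
      ((compl_adj _ _ _).2 ⟨huv, hnuv⟩)
      ((compl_adj _ _ _).2 ⟨hinj.ne (by decide), hn (by decide)⟩)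
  · exact hv 1 (hE u v (f 0) (f 1) huv ((hadj _ _).2 (by decide)) (fun h => hu 0 h.symm)
      (fun h => hu 1 h.symm) (fun h => hv 0 h.symm)).symm

/-- A graph without induced `C₄`, `2K₂` and `C₅` is split (Földes and Hammer). -/
theorem IsPseudoSplit.exists_ks_or [Fintype V] (h : IsPseudoSplit G) :
    (∃ K, KS G K) ∨ ∃ f, PentagonOn G Finset.univ f := by
  classical
  by_contra! hcon
  obtain ⟨hnK, hnP⟩ := hcon
  have hP : ∀ a b c d e, G.Adj a b → G.Adj b c → G.Adj c d → G.Adj d e → G.Adj e a →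
      ¬ G.Adj a c → ¬ G.Adj a d → ¬ G.Adj b d → ¬ G.Adj b e → ¬ G.Adj c e → False :=
    fun a b c d e h1 h2 h3 h4 h5 h6 h7 h8 h9 h10 =>
      hnP _ (h.pentagonOn (adj_iff_of_five h1 h2 h3 h4 h5 h6 h7 h8 h9 h10))
  obtain ⟨hC, hE⟩ := h
  rw [cycleGraph_four_isIndContained_iff] at hC
  rw [two_edges_isIndContained_iff] at hE
  push Not at hE hC
  replace hC : ∀ a b c d, G.Adj a b → G.Adj b c → G.Adj c d → G.Adj d a → a ≠ c → ¬ G.Adj a c →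
      b ≠ d → ¬ G.Adj b d → False := fun a b c d h1 h2 h3 h4 h5 h6 h7 h8 =>
    hC a b c d h1 h2 h3 h4 ((compl_adj _ _ _).2 ⟨h5, h6⟩) ((compl_adj _ _ _).2 ⟨h7, h8⟩)
  let e : Finset V → Finset (V × V) := fun K =>
    Finset.univ.filter fun p => p.1 ∉ K ∧ p.2 ∉ K ∧ G.Adj p.1 p.2
  -- Among the maximum cliques, `K` leaves the fewest edges outside. An edge `x y` that remains
  -- outside will produce a forbidden subgraph.
  obtain ⟨K, hK, hmin⟩ := Finset.exists_min_image
    (Finset.univ.filter fun K : Finset V => G.IsNClique G.cliqueNum K) (fun K => (e K).card)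
    (by obtain ⟨Q, hQ⟩ := G.exists_isNClique_cliqueNum; exact ⟨Q, by simpa using hQ⟩)
  simp only [Finset.mem_filter, Finset.mem_univ, true_and] at hK hmin
  have hKc : ∀ u ∈ K, ∀ v ∈ K, u ≠ v → G.Adj u v := fun u hu v hv huv => hK.isClique hu hv huv
  have hmax : ∀ Q : Finset V, (∀ u ∈ Q, ∀ v ∈ Q, u ≠ v → G.Adj u v) → Q.card ≤ K.card := by
    intro Q hQ
    have hQ' : G.IsClique (Q : Set V) := fun u hu v hv huv => hQ u hu v hv huv
    rw [hK.card_eq]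
    exact IsClique.card_le_cliqueNum (tc := hQ')
  have hmiss : ∀ x ∉ K, ∃ u ∈ K, ¬ G.Adj x u := by
    intro x hx
    by_contra! hcon
    have := hmax (insert x K) (by
      simp only [Finset.mem_insert]
      grind [SimpleGraph.Adj.symm])
    rw [Finset.card_insert_of_notMem hx] at this
    omega
  obtain ⟨x, hx, y, hy, hxy⟩ : ∃ x ∉ K, ∃ y ∉ K, G.Adj x y := by
    by_contra! hcon
    exact hnK K ⟨hKc, hcon⟩
  wlog hsub : ∀ u ∈ K, ¬ G.Adj x u → ¬ G.Adj y u generalizing x y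
  · push Not at hsub
    obtain ⟨u, hu, hxu, hyu⟩ := hsub
    refine this y hy x hx hxy.symm fun w hw hyw hxw => ?_
    have huw : u ≠ w := by rintro rfl; exact hyw hyu
    have hxu' : x ≠ u := by rintro rfl; exact hx hu
    have hyw' : y ≠ w := by rintro rfl; exact hy hw
    exact hC x y u w hxy hyu (hKc u hu w hw huw) hxw.symm hxu' hxu hyw' hyw
  obtain ⟨u, hu, hxu⟩ := hmiss x hx
  have hyu := hsub u hu hxu
  have hux : u ≠ x := by rintro rfl; exact hx hu
  have huy : u ≠ y := by rintro rfl; exact hy hu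
  have hxK : ∀ t ∈ K, t ≠ u → G.Adj x t := by
    intro t ht htu
    by_contra hxt
    exact hsub t ht hxt (hE x y u t hxy (hKc u hu t ht htu.symm) hxu hxt hyu)
  obtain ⟨w, hw, hwu, hyw⟩ : ∃ w ∈ K, w ≠ u ∧ ¬ G.Adj y w := by
    by_contra! hcon
    have := hmax (insert x (insert y (K.erase u))) (by
      simp only [Finset.mem_insert, Finset.mem_erase]
      grind [SimpleGraph.Adj.symm])
    rw [Finset.card_insert_of_notMem, Finset.card_insert_of_notMem (by simp [hy]),
      Finset.card_erase_add_one hu] at this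
    · omega
    · simp [hx, hxy.ne]
  have hxw := hxK w hw hwu
  have hwu' := hKc w hw u hu hwu
  -- Otherwise exchanging `u` for `x` gives a maximum clique with fewer edges outside: `x y`
  -- disappears and `u` contributes none.
  obtain ⟨z, hz, huz⟩ : ∃ z ∉ K, G.Adj u z := by
    by_contra! hcon
    have hK' : G.IsNClique G.cliqueNum (insert x (K.erase u)) := by
      refine ⟨?_, ?_⟩
      · intro a ha b hb hab
        simp only [Finset.coe_insert, Finset.coe_erase, Set.mem_insert_iff, Set.mem_sdiff,
          Finset.mem_coe, Set.mem_singleton_iff] at ha hb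
        grind [SimpleGraph.Adj.symm]
      · rw [Finset.card_insert_of_notMem (by simp [hx]), Finset.card_erase_add_one hu, hK.card_eq]
    have h1 := hmin _ hK'
    have h2 : e (insert x (K.erase u)) ⊂ e K := by
      rw [Finset.ssubset_iff_of_subset]
      · refine ⟨(x, y), ?_, ?_⟩
        · simp [e, hx, hy, hxy]
        · simp [e]
      · rintro ⟨a, b⟩ hab
        simp only [e, Finset.mem_filter, Finset.mem_univ, true_and, Finset.mem_insert,
          Finset.mem_erase, not_or, not_and] at hab ⊢
        obtain ⟨⟨ha1, ha2⟩, ⟨hb1, hb2⟩, hab⟩ := hab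
        have ha3 : a ∈ K → a = u := fun h => by
          by_contra h'
          exact ha2 h' h
        have hb3 : b ∈ K → b = u := fun h => by
          by_contra h'
          exact hb2 h' h
        refine ⟨fun ha => ?_, fun hb => ?_, hab⟩
        · have hau := ha3 ha
          subst hau
          by_cases hb : b ∈ K
          · exact hab.ne (hb3 hb).symm
          · exact hcon b hb hab
        · have hbu := hb3 hb
          subst hbu
          by_cases ha : a ∈ K
          · exact hab.ne (ha3 ha)
          · exact hcon a ha hab.symm
    have := Finset.card_lt_card h2
    omega
  by_cases hxz : G.Adj x z
  · obtain ⟨t, ht, hzt⟩ := hmiss z hz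
    have htu : t ≠ u := by rintro rfl; exact hzt huz.symm
    have hzt' : z ≠ t := by rintro rfl; exact hz ht
    exact hC x z u t hxz huz.symm (hKc u hu t ht htu.symm) (hxK t ht htu).symm hux.symm hxu
      hzt' hzt
  · have hyz : G.Adj y z := by
      by_contra hyz
      exact hyz (hE x y u z hxy huz hxu hxz hyu)
    have hxz' : x ≠ z := by rintro rfl; exact hxu huz.symm
    have hyw' : y ≠ w := by rintro rfl; exact hy hw
    have hzw : ¬ G.Adj z w := fun hzw => hC x y z w hxy hyz hzw hxw.symm hxz' hxz hyw' hyw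
    exact hP x y z u w hxy hyz huz.symm hwu'.symm hxw.symm hxz hxu hyu hyw hzw

theorem isPseudoSplit_iff [Fintype V] :
    IsPseudoSplit G ↔ IsSplit G ∨ ∃ f, PentagonOn G Finset.univ f := by
  rw [isSplit_iff]
  constructor
  · exact fun h => h.exists_ks_or
  · rintro (⟨K, h⟩ | ⟨f, h⟩)
    · exact h.isPseudoSplit
    · exact h.isPseudoSplit

end PseudoSplit

/-! ### Composing a core with a split graph, and recovering the pair `(H, K)` -/

section Composition

variable {V V' W : Type*}

/-- The graph obtained from the disjoint union of `Γ` and `H` by joining every vertex of `Γ` to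
every vertex of `K`. -/
def comp (Γ : SimpleGraph W) (H : SimpleGraph V) (K : Set V) : SimpleGraph (W ⊕ V) where
  Adj
    | Sum.inl a, Sum.inl b => Γ.Adj a b
    | Sum.inl _, Sum.inr v => v ∈ K
    | Sum.inr v, Sum.inl _ => v ∈ K
    | Sum.inr u, Sum.inr v => H.Adj u v
  symm := ⟨by
    rintro (a | u) (b | v) h
    · exact SimpleGraph.Adj.symm (G := Γ) h
    · exact h
    · exact h
    · exact SimpleGraph.Adj.symm (G := H) h⟩
  loopless := ⟨by
    rintro (a | u) h
    · exact Γ.irrefl h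
    · exact H.irrefl h⟩

variable {Γ : SimpleGraph W} {G H : SimpleGraph V} {G' H' : SimpleGraph V'} {K : Set V}
  {K' : Set V'}

@[simp] theorem comp_adj_inl_inl {a b : W} :
    (comp Γ H K).Adj (Sum.inl a) (Sum.inl b) ↔ Γ.Adj a b := Iff.rfl

@[simp] theorem comp_adj_inl_inr {a : W} {v : V} :
    (comp Γ H K).Adj (Sum.inl a) (Sum.inr v) ↔ v ∈ K := Iff.rfl

@[simp] theorem comp_adj_inr_inl {a : W} {v : V} :
    (comp Γ H K).Adj (Sum.inr v) (Sum.inl a) ↔ v ∈ K := Iff.rfl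

@[simp] theorem comp_adj_inr_inr {u v : V} :
    (comp Γ H K).Adj (Sum.inr u) (Sum.inr v) ↔ H.Adj u v := Iff.rfl

/-- An isomorphism respecting the distinguished sets extends to the compositions. -/
def compCongr (Γ : SimpleGraph W) (e : H ≃g H') (he : ∀ v, e v ∈ K' ↔ v ∈ K) :
    comp Γ H K ≃g comp Γ H' K' where
  toEquiv := Equiv.sumCongr (Equiv.refl W) e.toEquiv
  map_rel_iff' := by
    rintro (a | u) (b | v)
    · rfl
    · exact he v
    · exact he u
    · exact e.map_adj_iff

/-- An isomorphism of compositions that preserves the core restricts to the outer parts. -/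
theorem exists_iso_of_comp [Nonempty W] (e : comp Γ H K ≃g comp Γ H' K')
    (h1 : ∀ i, ∃ j, e (Sum.inl i) = Sum.inl j) (h2 : ∀ i, ∃ j, e.symm (Sum.inl i) = Sum.inl j) :
    ∃ e' : H ≃g H', ∀ v, e' v ∈ K' ↔ v ∈ K := by
  have h3 : ∀ v, ∃ v', e (Sum.inr v) = Sum.inr v' := by
    intro v
    rcases he : e (Sum.inr v) with j | v'
    · obtain ⟨i, hi⟩ := h2 j
      rw [← he, e.symm_apply_apply] at hi
      cases hi
    · exact ⟨v', rfl⟩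
  have h4 : ∀ v, ∃ v', e.symm (Sum.inr v) = Sum.inr v' := by
    intro v
    rcases he : e.symm (Sum.inr v) with j | v'
    · obtain ⟨i, hi⟩ := h1 j
      rw [← he, e.apply_symm_apply] at hi
      cases hi
    · exact ⟨v', rfl⟩
  choose g hg using h3
  choose g' hg' using h4
  refine ⟨⟨⟨g, g', fun v => ?_, fun v => ?_⟩, ?_⟩, ?_⟩
  · have := hg' (g v)
    rw [← hg, e.symm_apply_apply] at this
    exact (Sum.inr_injective this).symm
  · have := hg (g' v)
    rw [← hg', e.apply_symm_apply] at this
    exact (Sum.inr_injective this).symm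
  · intro u v
    have := e.map_adj_iff (v := Sum.inr u) (w := Sum.inr v)
    rw [hg, hg] at this
    exact this
  · intro v
    obtain ⟨i⟩ := ‹Nonempty W›
    obtain ⟨j, hj⟩ := h1 i
    have := e.map_adj_iff (v := Sum.inl i) (w := Sum.inr v)
    rw [hg, hj] at this
    exact this

theorem exists_comp [Fintype V] [Fintype W] {m : ℕ} {f : W → V} (hinj : Function.Injective f)
    (hadj : ∀ i j, G.Adj (f i) (f j) ↔ Γ.Adj i j)
    (hout : ∀ v, (∀ i, f i ≠ v) → (∀ i, G.Adj (f i) v) ∨ (∀ i, ¬ G.Adj (f i) v))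
    (hcard : Fintype.card V = Fintype.card W + m) :
    ∃ (H : SimpleGraph (Fin m)) (K : Set (Fin m)) (φ : comp Γ H K ≃g G),
      ∀ i, φ (Sum.inl i) = f i := by
  classical
  have hc : Fintype.card {v // v ∉ Set.range f} = m := by
    rw [Fintype.card_subtype_compl, hcard]
    have : Fintype.card {v // v ∈ Set.range f} = Fintype.card W :=
      (Fintype.card_congr (Equiv.ofInjective f hinj)).symm
    rw [this]; omega
  let ε := (Fintype.equivFinOfCardEq hc).symm
  have hε : ∀ i j, f i ≠ ε j := fun i j h => (ε j).2 ⟨i, h⟩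
  have hbij : Function.Bijective (Sum.elim f fun j => (ε j : V)) := by
    refine ⟨hinj.sumElim (Subtype.val_injective.comp ε.injective) hε, fun v => ?_⟩
    by_cases hv : v ∈ Set.range f
    · obtain ⟨i, rfl⟩ := hv
      exact ⟨Sum.inl i, rfl⟩
    · exact ⟨Sum.inr (ε.symm ⟨v, hv⟩), by simp⟩
  have hK : ∀ i j, G.Adj (f i) (ε j) ↔ ∀ i, G.Adj (f i) (ε j) := by
    intro i j
    refine ⟨fun h => ?_, fun h => h i⟩
    exact (hout (ε j) (fun i => hε i j)).resolve_right fun h' => h' i h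
  refine ⟨G.comap fun j => (ε j : V), {j | ∀ i, G.Adj (f i) (ε j)},
    ⟨Equiv.ofBijective _ hbij, ?_⟩, fun i => rfl⟩
  rintro (a | u) (b | v)
  · exact hadj a b
  · exact hK a v
  · exact (G.adj_comm _ _).trans (hK b u)
  · exact Iff.rfl

theorem SwingOn.map [Fintype V] [Fintype V'] {a : V} (h : SwingOn G Finset.univ a) (e : G ≃g G') :
    SwingOn G' Finset.univ (e a) := by
  have key : ∀ u, G'.Adj (e a) u ↔ G.Adj a (e.symm u) := fun u => by
    rw [← e.map_adj_iff, e.apply_symm_apply]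
  have key' : ∀ u v, G'.Adj u v ↔ G.Adj (e.symm u) (e.symm v) := fun u v => by
    rw [← e.map_adj_iff, e.apply_symm_apply, e.apply_symm_apply]
  refine ⟨Finset.mem_univ _, fun u _ v _ hu hv huv => ?_, fun u _ v _ hu hv => ?_⟩
  · rw [key] at hu hv
    rw [key']
    exact h.clique _ (Finset.mem_univ _) _ (Finset.mem_univ _) hu hv (e.symm.injective.ne huv)
  · rw [key] at hu hv
    rw [key']
    exact h.indep _ (Finset.mem_univ _) _ (Finset.mem_univ _) hu hv

theorem PentagonOn.map [Fintype V] [Fintype V'] {f : Fin 5 → V} (h : PentagonOn G Finset.univ f)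
    (e : G ≃g G') : PentagonOn G' Finset.univ (fun i => e (f i)) := by
  have key : ∀ i u, G'.Adj (e (f i)) u ↔ G.Adj (f i) (e.symm u) := fun i u => by
    rw [← e.map_adj_iff, e.apply_symm_apply]
  have key' : ∀ u v, G'.Adj u v ↔ G.Adj (e.symm u) (e.symm v) := fun u v => by
    rw [← e.map_adj_iff, e.apply_symm_apply, e.apply_symm_apply]
  refine ⟨fun i => Finset.mem_univ _, fun i j hij => h.inj (e.injective hij),
    fun i j => e.map_adj_iff.trans (h.adj i j), fun v _ hv => ?_, fun u _ v _ hu hv huv => ?_,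
    fun u _ v _ hu hv => ?_⟩
  · simp only [key]
    refine h.out _ (Finset.mem_univ _) fun i hi => hv i ?_
    rw [hi, e.apply_symm_apply]
  · simp only [key] at hu hv
    rw [key']
    exact h.clique _ (Finset.mem_univ _) _ (Finset.mem_univ _) hu hv (e.symm.injective.ne huv)
  · simp only [key] at hu hv
    rw [key']
    exact h.indep _ (Finset.mem_univ _) _ (Finset.mem_univ _) hu hv

theorem swingOn_comp_iff [Fintype V] :
    SwingOn (comp (⊥ : SimpleGraph Unit) H K) Finset.univ (Sum.inl ()) ↔ KS H K := by
  constructor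
  · intro h
    refine ⟨fun u hu v hv huv => ?_, fun u hu v hv => ?_⟩
    · exact h.clique (Sum.inr u) (Finset.mem_univ _) (Sum.inr v) (Finset.mem_univ _) hu hv
        (Sum.inr_injective.ne huv)
    · exact h.indep (Sum.inr u) (Finset.mem_univ _) (Sum.inr v) (Finset.mem_univ _) hu hv
  · intro h
    refine ⟨Finset.mem_univ _, ?_, ?_⟩
    · rintro (a | u) - (b | v) - hu hv huv
      · exact absurd rfl huv
      · exact hv
      · exact hu
      · exact h.clique u hu v hv fun h => huv (congrArg _ h)
    · rintro (a | u) - (b | v) - hu hv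
      · exact fun h => h
      · exact hv
      · exact hu
      · exact h.indep u hu v hv

theorem pentagonOn_comp_iff [Fintype V] :
    PentagonOn (comp (cycleGraph 5) H K) Finset.univ Sum.inl ↔ KS H K := by
  constructor
  · intro h
    refine ⟨fun u hu v hv huv => ?_, fun u hu v hv => ?_⟩
    · exact h.clique (Sum.inr u) (Finset.mem_univ _) (Sum.inr v) (Finset.mem_univ _)
        (fun _ => hu) (fun _ => hv) (Sum.inr_injective.ne huv)
    · exact h.indep (Sum.inr u) (Finset.mem_univ _) (Sum.inr v) (Finset.mem_univ _)
        (fun _ => hu) (fun _ => hv)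
  · intro h
    refine ⟨fun _ => Finset.mem_univ _, Sum.inl_injective, cycleGraph_five_adj, ?_, ?_, ?_⟩
    · rintro (a | u) - hne
      · exact absurd rfl (hne a)
      · by_cases hu : u ∈ K
        · exact Or.inl fun _ => hu
        · exact Or.inr fun _ => hu
    · rintro (a | u) - (b | v) - hu hv huv
      · exact absurd rfl (hu a).ne
      · exact absurd rfl (hu a).ne
      · exact absurd rfl (hv b).ne
      · exact h.clique u (hu 0) v (hv 0) fun h => huv (congrArg _ h)
    · have key : ∀ a : Fin 5, (cycleGraph 5).Adj (a + 1) a := by decide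
      rintro (a | u) - (b | v) - hu hv
      · exact absurd (key a) (hu (a + 1))
      · exact absurd (key a) (hu (a + 1))
      · exact absurd (key b) (hv (b + 1))
      · exact h.indep u (hu 0) v (hv 0)

/-- Exchanging two twins is an automorphism. -/
def swapIso [DecidableEq V] {a b : V} (h : ∀ v, v ≠ a → v ≠ b → (G.Adj a v ↔ G.Adj b v)) :
    G ≃g G where
  toEquiv := Equiv.swap a b
  map_rel_iff' := by
    intro u v
    rw [Equiv.swap_apply_def, Equiv.swap_apply_def]
    have h' : ∀ v, v ≠ a → v ≠ b → (G.Adj v a ↔ G.Adj v b) := fun v h1 h2 => by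
      rw [G.adj_comm v, G.adj_comm v, h v h1 h2]
    have := G.adj_comm a b
    split_ifs <;> subst_vars <;> simp_all

theorem swapIso_apply [DecidableEq V] {a b : V}
    (h : ∀ v, v ≠ a → v ≠ b → (G.Adj a v ↔ G.Adj b v)) (v : V) :
    swapIso h v = Equiv.swap a b v := rfl

/-- The isomorphism need not fix the core vertex, but it sends it to a swing vertex, hence to a twin
of the core; a swap corrects this. -/
theorem exists_iso_of_comp_unit [Fintype V] [Fintype V'] (hK : KS H K) (hK' : KS H' K')
    (h : Nonempty (comp (⊥ : SimpleGraph Unit) H K ≃g comp (⊥ : SimpleGraph Unit) H' K')) :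
    ∃ e' : H ≃g H', ∀ v, e' v ∈ K' ↔ v ∈ K := by
  classical
  obtain ⟨e⟩ := h
  have h1 := (swingOn_comp_iff.2 hK).map e
  have h2 := swingOn_comp_iff.2 hK'
  let σ := swapIso (fun v hva hvb => h1.adj_iff h2 hva hvb)
  have hσ : (e.trans σ) (Sum.inl ()) = Sum.inl () := by
    change Equiv.swap _ _ _ = _
    exact Equiv.swap_apply_left _ _
  refine exists_iso_of_comp (e.trans σ) (fun i => ⟨(), hσ⟩) (fun i => ⟨(), ?_⟩)
  rw [RelIso.symm_apply_eq]
  exact hσ.symm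

/-- The core is the part A of the composition, so every isomorphism preserves it. -/
theorem exists_iso_of_comp_pentagon [Fintype V] [Fintype V'] (hK : KS H K) (hK' : KS H' K')
    (h : Nonempty (comp (cycleGraph 5) H K ≃g comp (cycleGraph 5) H' K')) :
    ∃ e' : H ≃g H', ∀ v, e' v ∈ K' ↔ v ∈ K := by
  obtain ⟨e⟩ := h
  have h1 := (pentagonOn_comp_iff.2 hK).map e
  have h2 := pentagonOn_comp_iff.2 hK'
  have h3 := h1.aPart_eq.symm.trans h2.aPart_eq
  refine exists_iso_of_comp e (fun i => ?_) (fun i => ?_)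
  · obtain ⟨j, hj⟩ : e (Sum.inl i) ∈ Set.range Sum.inl := h3 ▸ ⟨i, rfl⟩
    exact ⟨j, hj.symm⟩
  · obtain ⟨j, hj⟩ : Sum.inl i ∈ Set.range fun i => e (Sum.inl i) := h3 ▸ ⟨i, rfl⟩
    exact ⟨j, by rw [← hj]; exact e.symm_apply_apply _⟩

theorem KS.map (h : KS H K) (e : H ≃g H') : KS H' {v | e.symm v ∈ K} := by
  have key' : ∀ u v, H'.Adj u v ↔ H.Adj (e.symm u) (e.symm v) := fun u v => by
    rw [← e.map_adj_iff, e.apply_symm_apply, e.apply_symm_apply]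
  refine ⟨fun u hu v hv huv => ?_, fun u hu v hv => ?_⟩ <;> rw [key']
  · exact h.clique _ hu _ hv (e.symm.injective.ne huv)
  · exact h.indep _ hu _ hv

/-- No vertex outside of `K` is adjacent to all vertices of `K`. -/
def IsFull (H : SimpleGraph V) (K : Set V) : Prop := ∀ s ∉ K, ∃ k ∈ K, ¬ H.Adj s k

/-- One enlargement suffices: once `s` joins the clique side, it is itself missed by every vertex
still outside. -/
theorem KS.exists_isFull (h : KS H K) : ∃ L, KS H L ∧ IsFull H L := by
  by_cases hK : IsFull H K
  · exact ⟨K, h, hK⟩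
  simp only [IsFull] at hK
  push Not at hK
  obtain ⟨s, hs, hsK⟩ := hK
  refine ⟨insert s K, ⟨?_, ?_⟩, ?_⟩
  · rintro u (rfl | hu) v (rfl | hv) huv
    · exact absurd rfl huv
    · exact hsK v hv
    · exact (hsK u hu).symm
    · exact h.clique u hu v hv huv
  · intro u hu v hv
    exact h.indep u (fun h => hu (Or.inr h)) v (fun h => hv (Or.inr h))
  · intro t ht
    exact ⟨s, Or.inl rfl, h.indep t (fun h => ht (Or.inr h)) s hs⟩

/-- The full clique side of a split graph is unique up to automorphisms. -/
theorem KS.exists_aut {L : Set V} (hK : KS H K) (hL : KS H L) (hfK : IsFull H K)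
    (hfL : IsFull H L) : ∃ σ : H ≃g H, ∀ v, σ v ∈ L ↔ v ∈ K := by
  classical
  -- Two such vertices would be adjacent within `A` and nonadjacent outside `B`. So `K` and `L` are
  -- equal or differ by exchanging one `x` for one `y`, and these turn out to be twins.
  have key : ∀ {A B : Set V}, KS H A → KS H B → ∀ x y, x ∈ A → x ∉ B → y ∈ A → y ∉ B → x = y := by
    intro A B hA hB x y hxA hxB hyA hyB
    by_contra hxy
    exact hB.indep x hxB y hyB (hA.clique x hxA y hyA hxy)
  have key2 : ∀ {A B : Set V}, KS H A → KS H B → IsFull H A → (∃ y ∈ B, y ∉ A) →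
      ∃ x ∈ A, x ∉ B := by
    rintro A B hA hB hfA ⟨y, hyB, hyA⟩
    obtain ⟨k, hk, hyk⟩ := hfA y hyA
    exact ⟨k, hk, fun hkB => hyk (hB.clique y hyB k hkB fun h => hyA (h ▸ hk))⟩
  by_cases hsub : ∃ x ∈ K, x ∉ L
  swap
  · have h1 : ¬ ∃ y ∈ L, y ∉ K := fun h => hsub (key2 hK hL hfK h)
    push Not at hsub h1
    exact ⟨RelIso.refl _, fun v => ⟨h1 v, hsub v⟩⟩
  obtain ⟨y, hyL, hyK⟩ := key2 hL hK hfL hsub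
  obtain ⟨x, hxK, hxL⟩ := hsub
  have hmem : ∀ v, v ≠ x → v ≠ y → (v ∈ K ↔ v ∈ L) := by
    intro v hvx hvy
    constructor
    · intro hvK
      by_contra hvL
      exact hvx (key hK hL v x hvK hvL hxK hxL)
    · intro hvL
      by_contra hvK
      exact hvy (key hL hK v y hvL hvK hyL hyK)
  have htwin : ∀ v, v ≠ x → v ≠ y → (H.Adj x v ↔ H.Adj y v) := by
    intro v hvx hvy
    by_cases hvK : v ∈ K
    · exact iff_of_true (hK.clique x hxK v hvK hvx.symm)
        (hL.clique y hyL v ((hmem v hvx hvy).1 hvK) hvy.symm)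
    · exact iff_of_false (hL.indep x hxL v fun h => hvK ((hmem v hvx hvy).2 h))
        (hK.indep y hyK v hvK)
  refine ⟨swapIso htwin, fun v => ?_⟩
  rw [swapIso_apply, Equiv.swap_apply_def]
  split_ifs with h1 h2
  · subst h1; simp [hyL, hxK]
  · subst h2; simp [hxL, hyK]
  · exact (hmem v h1 h2).symm

end Composition

/-! ### Counting isomorphism classes -/

section Counting

instance (n : ℕ) : Finite (UnlabeledGraph n) := by
  unfold UnlabeledGraph
  infer_instance

theorem mk_eq_mk_iff {n : ℕ} {G H : SimpleGraph (Fin n)} :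
    Quotient.mk (isoSetoid n) G = Quotient.mk (isoSetoid n) H ↔ Nonempty (G ≃g H) :=
  Quotient.eq (r := isoSetoid n)

theorem ncard_unlabeledClass_le {m n : ℕ} {P : SimpleGraph (Fin m) → Prop}
    {Q : SimpleGraph (Fin n) → Prop} (R : SimpleGraph (Fin m) → SimpleGraph (Fin n) → Prop)
    (hP : ∀ G, P G → ∃ H, Q H ∧ R G H)
    (h : ∀ G H G' H', R G H → R G' H' → Nonempty (H ≃g H') → Nonempty (G ≃g G')) :
    (unlabeledClass m P).ncard ≤ (unlabeledClass n Q).ncard := by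
  have hrep : ∀ q : unlabeledClass m P, ∃ G H, Quotient.mk (isoSetoid m) G = q.1 ∧ Q H ∧ R G H := by
    rintro ⟨q, G, hG, hq⟩
    obtain ⟨H, hH, hR⟩ := hP G hG
    exact ⟨G, H, hq, hH, hR⟩
  choose g k hg hQ hR using hrep
  rw [← Nat.card_coe_set_eq, ← Nat.card_coe_set_eq]
  refine Nat.card_le_card_of_injective
    (fun q => (⟨Quotient.mk (isoSetoid n) (k q), k q, hQ q, rfl⟩ : unlabeledClass n Q)) ?_
  intro q q' he
  have he := mk_eq_mk_iff.1 (congrArg Subtype.val he)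
  apply Subtype.ext
  exact (hg q).symm.trans ((mk_eq_mk_iff.2 (h _ _ _ _ (hR q) (hR q') he)).trans (hg q'))

/-- A relation that induces a bijection of isomorphism classes. -/
theorem ncard_unlabeledClass_eq {m n : ℕ} {P : SimpleGraph (Fin m) → Prop}
    {Q : SimpleGraph (Fin n) → Prop} (R : SimpleGraph (Fin m) → SimpleGraph (Fin n) → Prop)
    (hP : ∀ G, P G → ∃ H, Q H ∧ R G H) (hQ : ∀ H, Q H → ∃ G, P G ∧ R G H)
    (h : ∀ G H G' H', R G H → R G' H' → (Nonempty (G ≃g G') ↔ Nonempty (H ≃g H'))) :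
    (unlabeledClass m P).ncard = (unlabeledClass n Q).ncard :=
  le_antisymm
    (ncard_unlabeledClass_le R hP fun G H G' H' h1 h2 => (h G H G' H' h1 h2).2)
    (ncard_unlabeledClass_le (fun H G => R G H) hQ fun H G H' G' h1 h2 => (h G H G' H' h1 h2).1)

theorem ncard_unlabeledClass_or {n : ℕ} {P Q T : SimpleGraph (Fin n) → Prop}
    (hT : ∀ G, T G ↔ P G ∨ Q G) (hdisj : ∀ G, P G → ¬ Q G)
    (hiso : ∀ G H, Nonempty (G ≃g H) → P G → P H) :
    (unlabeledClass n T).ncard = (unlabeledClass n P).ncard + (unlabeledClass n Q).ncard := by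
  rw [← Set.ncard_union_eq]
  · congr 1
    ext q
    constructor
    · rintro ⟨G, hG, rfl⟩
      exact ((hT G).1 hG).imp (fun h => ⟨G, h, rfl⟩) (fun h => ⟨G, h, rfl⟩)
    · rintro (⟨G, hG, rfl⟩ | ⟨G, hG, rfl⟩)
      · exact ⟨G, (hT G).2 (Or.inl hG), rfl⟩
      · exact ⟨G, (hT G).2 (Or.inr hG), rfl⟩
  · rw [Set.disjoint_left]
    rintro q ⟨G, hG, rfl⟩ ⟨H, hH, he⟩
    exact hdisj H (hiso G H (mk_eq_mk_iff.1 he.symm) hG) hH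

theorem unlabeledClass_congr {n : ℕ} {P Q : SimpleGraph (Fin n) → Prop} (h : ∀ G, P G ↔ Q G) :
    unlabeledClass n P = unlabeledClass n Q := by
  rw [funext fun G => propext (h G)]

section

variable {V V' : Type*} [Fintype V] [Fintype V'] {G : SimpleGraph V} {G' : SimpleGraph V'}

/-- There is a swing vertex. -/
def HasSwing (G : SimpleGraph V) : Prop := ∃ a, SwingOn G Finset.univ a

/-- There are two nonadjacent swing vertices. -/
def HasTwoSwings (G : SimpleGraph V) : Prop :=
  ∃ a b, SwingOn G Finset.univ a ∧ SwingOn G Finset.univ b ∧ a ≠ b ∧ ¬ G.Adj a b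

/-- The graph is the composition of a 5-cycle and a split graph. -/
def HasPentagon (G : SimpleGraph V) : Prop := ∃ f, PentagonOn G Finset.univ f

theorem HasSwing.map (h : HasSwing G) (e : G ≃g G') : HasSwing G' := by
  obtain ⟨a, ha⟩ := h
  exact ⟨_, ha.map e⟩

theorem HasTwoSwings.map (h : HasTwoSwings G) (e : G ≃g G') : HasTwoSwings G' := by
  obtain ⟨a, b, ha, hb, hab, hn⟩ := h
  exact ⟨_, _, ha.map e, hb.map e, e.injective.ne hab, fun h => hn (e.map_adj_iff.1 h)⟩

theorem HasPentagon.map (h : HasPentagon G) (e : G ≃g G') : HasPentagon G' := by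
  obtain ⟨f, hf⟩ := h
  exact ⟨_, hf.map e⟩

theorem isNG1_iff' : IsNG1 G ↔ HasSwing G ∧ ¬ HasTwoSwings G := by
  rw [isNG1_iff, HasSwing, HasTwoSwings]
  push Not
  rfl

theorem HasPentagon.not_hasSwing (h : HasPentagon G) : ¬ HasSwing G := by
  obtain ⟨f, hf⟩ := h
  rintro ⟨a, ha⟩
  exact hf.not_swing a ha

theorem SwingOn.exists_comp {m : ℕ} {G : SimpleGraph (Fin (m + 1))} {a : Fin (m + 1)}
    (ha : SwingOn G Finset.univ a) :
    ∃ (H : SimpleGraph (Fin m)) (K : Set (Fin m)) (φ : comp (⊥ : SimpleGraph Unit) H K ≃g G),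
      φ (Sum.inl ()) = a ∧ KS H K := by
  obtain ⟨H, K, φ, hφ⟩ := SplitNG.exists_comp (G := G) (Γ := (⊥ : SimpleGraph Unit)) (m := m)
    (f := fun _ => a) (fun _ _ _ => rfl) (fun _ _ => by simp)
    (fun v _ => by by_cases h : G.Adj a v <;> simp [h]) (by simp [add_comm])
  refine ⟨H, K, φ, hφ (), ?_⟩
  have := ha.map φ.symm
  rw [← hφ (), φ.symm_apply_apply] at this
  exact swingOn_comp_iff.1 this

theorem PentagonOn.exists_comp {m : ℕ} {G : SimpleGraph (Fin (m + 5))} {f : Fin 5 → Fin (m + 5)}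
    (hf : PentagonOn G Finset.univ f) :
    ∃ (H : SimpleGraph (Fin m)) (K : Set (Fin m)),
      KS H K ∧ Nonempty (G ≃g comp (cycleGraph 5) H K) := by
  obtain ⟨H, K, φ, hφ⟩ := SplitNG.exists_comp (G := G) (Γ := cycleGraph 5) (m := m)
    hf.inj (fun i j => by rw [hf.adj, cycleGraph_five_adj])
    (fun v => hf.out v (Finset.mem_univ v)) (by simp [add_comm])
  refine ⟨H, K, ?_, ⟨φ.symm⟩⟩
  have := hf.map φ.symm
  have h2 : (fun i => φ.symm (f i)) = Sum.inl := by
    funext i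
    rw [← hφ, φ.symm_apply_apply]
  rw [h2] at this
  exact pentagonOn_comp_iff.1 this

theorem exists_overFin_iso {n : ℕ} (G : SimpleGraph V) (h : Fintype.card V = n) :
    ∃ G' : SimpleGraph (Fin n), Nonempty (G' ≃g G) :=
  ⟨G.overFin h, ⟨(G.overFinIso h).symm⟩⟩

end

/-- Both sides count pairs `(H, K)` up to isomorphism; the bijection replaces the 5-cycle by a
single vertex. -/
theorem ncard_hasPentagon (m : ℕ) :
    (unlabeledClass (m + 5) HasPentagon).ncard = (unlabeledClass (m + 1) HasSwing).ncard := by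
  refine ncard_unlabeledClass_eq (fun G G' => ∃ (H : SimpleGraph (Fin m)) (K : Set (Fin m)),
    KS H K ∧ Nonempty (G ≃g comp (cycleGraph 5) H K) ∧
      Nonempty (G' ≃g comp (⊥ : SimpleGraph Unit) H K)) ?_ ?_ ?_
  · rintro G ⟨f, hf⟩
    obtain ⟨H, K, hK, hG⟩ := hf.exists_comp
    obtain ⟨G', ⟨e⟩⟩ := exists_overFin_iso (n := m + 1) (comp (⊥ : SimpleGraph Unit) H K)
      (by simp [add_comm])
    exact ⟨G', ⟨_, (swingOn_comp_iff.2 hK).map e.symm⟩, H, K, hK, hG, ⟨e⟩⟩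
  · rintro G' ⟨a, ha⟩
    obtain ⟨H, K, φ, -, hK⟩ := ha.exists_comp
    obtain ⟨G, ⟨e⟩⟩ := exists_overFin_iso (n := m + 5) (comp (cycleGraph 5) H K)
      (by simp [add_comm])
    exact ⟨G, ⟨_, (pentagonOn_comp_iff.2 hK).map e.symm⟩, H, K, hK, ⟨e⟩, ⟨φ.symm⟩⟩
  · rintro G1 G1' G2 G2' ⟨H, K, hK, ⟨e1⟩, ⟨e1'⟩⟩ ⟨L, M, hM, ⟨e2⟩, ⟨e2'⟩⟩
    constructor
    · rintro ⟨e⟩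
      obtain ⟨e', he'⟩ := exists_iso_of_comp_pentagon hK hM ⟨e1.symm.trans (e.trans e2)⟩
      exact ⟨e1'.trans ((compCongr _ e' he').trans e2'.symm)⟩
    · rintro ⟨e⟩
      obtain ⟨e', he'⟩ := exists_iso_of_comp_unit hK hM ⟨e1'.symm.trans (e.trans e2')⟩
      exact ⟨e1.trans ((compCongr _ e' he').trans e2.symm)⟩

/-- A swing vertex not adjacent to the core is a twin of it, that is, a vertex outside `K` adjacent
to all of `K`. -/
theorem KS.hasTwoSwings_iff {V : Type*} [Fintype V] {H : SimpleGraph V} {K : Set V} (hK : KS H K) :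
    HasTwoSwings (comp (⊥ : SimpleGraph Unit) H K) ↔ ¬ IsFull H K := by
  have ha := swingOn_comp_iff.2 hK
  constructor
  · rintro ⟨b, c, hb, hc, hbc, hn⟩ hfull
    have key : ∀ b, SwingOn (comp (⊥ : SimpleGraph Unit) H K) Finset.univ b → b ≠ Sum.inl () →
        (comp (⊥ : SimpleGraph Unit) H K).Adj (Sum.inl ()) b := by
      rintro (b | s) hb hne
      · exact absurd rfl hne
      · by_contra hs
        obtain ⟨k, hk, hsk⟩ := hfull s hs
        have hks : k ≠ s := fun h => hs (h ▸ hk)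
        exact hsk ((ha.adj_iff hb (v := Sum.inr k) Sum.inr_ne_inl (Sum.inr_injective.ne hks)).1 hk)
    by_cases hb0 : b = Sum.inl ()
    · subst hb0
      exact hn (key c hc hbc.symm)
    by_cases hc0 : c = Sum.inl ()
    · subst hc0
      exact hn (key b hb hbc).symm
    exact hn ((ha.adj_iff hc hb0 hbc).1 (key b hb hb0)).symm
  · intro hfull
    simp only [IsFull] at hfull
    push Not at hfull
    obtain ⟨s, hs, hsK⟩ := hfull
    refine ⟨Sum.inl (), Sum.inr s, ha, ha.of_twins ?_, Sum.inl_ne_inr, hs⟩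
    rintro (b | v) hb hv
    · exact absurd rfl hb
    · by_cases hvK : v ∈ K
      · exact iff_of_true hvK (hsK v hvK)
      · exact iff_of_false hvK (hK.indep s hs v hvK)

/-- Such a graph corresponds to a pair `(H, K)` with `K` full; every split `H` has such a `K`, and
`KS.exists_aut` shows that the choice does not matter. -/
theorem ncard_isNG1 (m : ℕ) : (unlabeledClass (m + 1) IsNG1).ncard = splitCount m := by
  refine ncard_unlabeledClass_eq (fun G H => ∃ K : Set (Fin m), KS H K ∧ IsFull H K ∧
      Nonempty (G ≃g comp (⊥ : SimpleGraph Unit) H K)) ?_ ?_ ?_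
  · intro G hG
    rw [isNG1_iff'] at hG
    obtain ⟨⟨a, ha⟩, hn⟩ := hG
    obtain ⟨H, K, φ, -, hK⟩ := ha.exists_comp
    refine ⟨H, isSplit_iff.2 ⟨K, hK⟩, K, hK, ?_, ⟨φ.symm⟩⟩
    by_contra hfull
    exact hn ((hK.hasTwoSwings_iff.2 hfull).map φ)
  · intro H hH
    obtain ⟨K, hK⟩ := isSplit_iff.1 hH
    obtain ⟨L, hL, hfull⟩ := hK.exists_isFull
    obtain ⟨G, ⟨e⟩⟩ := exists_overFin_iso (n := m + 1) (comp (⊥ : SimpleGraph Unit) H L)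
      (by simp [add_comm])
    refine ⟨G, isNG1_iff'.2 ⟨⟨_, (swingOn_comp_iff.2 hL).map e.symm⟩, fun h => ?_⟩, L, hL, hfull, ⟨e⟩⟩
    exact hL.hasTwoSwings_iff.1 (h.map e) hfull
  · rintro G H G' H' ⟨K, hK, hfK, ⟨e⟩⟩ ⟨K', hK', hfK', ⟨e'⟩⟩
    constructor
    · rintro ⟨i⟩
      obtain ⟨j, -⟩ := exists_iso_of_comp_unit hK hK' ⟨e.symm.trans (i.trans e')⟩
      exact ⟨j⟩
    · rintro ⟨i⟩
      have hf : IsFull H' {v | i.symm v ∈ K} := by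
        intro s hs
        obtain ⟨k, hk, hsk⟩ := hfK _ hs
        refine ⟨i k, by simpa using hk, fun h => hsk ?_⟩
        rw [← i.map_adj_iff, i.apply_symm_apply]
        exact h
      obtain ⟨σ, hσ⟩ := (hK.map i).exists_aut hK' hf hfK'
      refine ⟨e.trans ((compCongr _ (i.trans σ) fun v => ?_).trans e'.symm)⟩
      exact (hσ (i v)).trans (by simp)

/-- Delete one of two nonadjacent swing vertices: the other, `w`, is still a swing vertex, and `K`
must be its neighbourhood. Going back duplicates `w`, and since swing vertices are twins, any choice
of `w` gives the same graph. -/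
theorem ncard_hasTwoSwings (m : ℕ) :
    (unlabeledClass (m + 1) HasTwoSwings).ncard = (unlabeledClass m HasSwing).ncard := by
  classical
  refine ncard_unlabeledClass_eq (fun G H => ∃ w, SwingOn H Finset.univ w ∧
      Nonempty (G ≃g comp (⊥ : SimpleGraph Unit) H {v | H.Adj w v})) ?_ ?_ ?_
  · rintro G ⟨a, b, ha, hb, hab, hn⟩
    obtain ⟨H, K, φ, hφ, hK⟩ := ha.exists_comp
    obtain ⟨w, hw⟩ : ∃ w, φ.symm b = Sum.inr w := by
      rcases h : φ.symm b with i | w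
      · rw [RelIso.symm_apply_eq] at h
        exact absurd (h.trans hφ) hab.symm
      · exact ⟨w, rfl⟩
    have hb' := hb.map φ.symm
    rw [hw] at hb'
    have ha' := swingOn_comp_iff.2 hK
    have hwK : w ∉ K := by
      intro h
      apply hn
      rw [← hφ, ← φ.apply_symm_apply b, hw, φ.map_adj_iff]
      exact h
    have hN : K = {v | H.Adj w v} := by
      ext v
      by_cases hv : v = w
      · subst hv
        exact iff_of_false hwK (SimpleGraph.irrefl H)
      · exact ha'.adj_iff hb' (v := Sum.inr v) Sum.inr_ne_inl (Sum.inr_injective.ne hv)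
    subst hN
    refine ⟨H, ⟨w, ?_⟩, w, ?_, ⟨φ.symm⟩⟩ <;>
      exact ⟨Finset.mem_univ _, fun u _ v _ => hK.clique u |> fun h hu hv => h hu v hv,
        fun u _ v _ hu hv => hK.indep u hu v hv⟩
  · rintro H ⟨w, hw⟩
    obtain ⟨G, ⟨e⟩⟩ := exists_overFin_iso (n := m + 1)
      (comp (⊥ : SimpleGraph Unit) H {v | H.Adj w v}) (by simp [add_comm])
    refine ⟨G, (hw.ks.hasTwoSwings_iff.2 fun hfull => ?_).map e.symm, w, hw, ⟨e⟩⟩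
    obtain ⟨k, hk, hwk⟩ := hfull w (SimpleGraph.irrefl H)
    exact hwk hk
  · rintro G H G' H' ⟨w, hw, ⟨e⟩⟩ ⟨w', hw', ⟨e'⟩⟩
    constructor
    · rintro ⟨i⟩
      obtain ⟨j, -⟩ := exists_iso_of_comp_unit hw.ks hw'.ks ⟨e.symm.trans (i.trans e')⟩
      exact ⟨j⟩
    · rintro ⟨i⟩
      let σ := swapIso (fun v hva hvb => (hw.map i).adj_iff hw' hva hvb)
      have hσ : σ (i w) = w' := Equiv.swap_apply_left _ _
      refine ⟨e.trans ((compCongr _ (i.trans σ) fun v => ?_).trans e'.symm)⟩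
      change H'.Adj w' (σ (i v)) ↔ H.Adj w v
      rw [← hσ, σ.map_adj_iff, i.map_adj_iff]

theorem ncard_hasSwing (n : ℕ) :
    (unlabeledClass n HasSwing).ncard = ∑ i ∈ Finset.range n, splitCount i := by
  induction n with
  | zero =>
    rw [Finset.sum_range_zero, Set.ncard_eq_zero]
    ext q
    simp only [Set.mem_empty_iff_false, iff_false]
    rintro ⟨G, ⟨a, -⟩, -⟩
    exact a.elim0
  | succ m ih =>
    -- The recursion u_{m+1} = u_m + s_m: either two swing vertices are nonadjacent, or they all
    -- form a clique.
    rw [Finset.sum_range_succ, ← ih, ← ncard_isNG1, ← ncard_hasTwoSwings m]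
    refine ncard_unlabeledClass_or (P := HasTwoSwings) (Q := IsNG1) (fun G => ?_) (fun G h1 h2 => (isNG1_iff'.1 h2).2 h1) ?_
    · rw [isNG1_iff']
      have : HasTwoSwings G → HasSwing G := fun ⟨a, _, ha, _⟩ => ⟨a, ha⟩
      tauto
    · rintro G H ⟨e⟩ h
      exact h.map e

end Counting

end SplitNG

/-- Counting formulas for unlabeled graphs on `n ≥ 1` vertices. The sum over
`0 ≤ i ≤ n - 5` is written over `Finset.range (n - 4)`; it is empty when `n < 5`. -/
theorem corollary5p1 (n : ℕ) (hn : 1 ≤ n) :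
    (SplitNG.unlabeledClass n SplitNG.IsUnbalanced).ncard
        = ∑ i ∈ Finset.range n, SplitNG.splitCount i ∧
    ((SplitNG.unlabeledClass n SplitNG.IsBalanced).ncard : ℤ)
        = (SplitNG.splitCount n : ℤ) - ∑ i ∈ Finset.range n, (SplitNG.splitCount i : ℤ) ∧
    (SplitNG.unlabeledClass n SplitNG.IsNG1).ncard = SplitNG.splitCount (n - 1) ∧
    (SplitNG.unlabeledClass n SplitNG.IsNG2).ncard = SplitNG.splitCount (n - 1) ∧
    (SplitNG.unlabeledClass n SplitNG.IsNG3).ncard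
        = ∑ i ∈ Finset.range (n - 4), SplitNG.splitCount i ∧
    (SplitNG.unlabeledClass n SplitNG.IsNG).ncard
        = ∑ i ∈ Finset.range n, SplitNG.splitCount i
          + ∑ i ∈ Finset.range (n - 4), SplitNG.splitCount i ∧
    (SplitNG.unlabeledClass n SplitNG.IsPseudoSplit).ncard
        = SplitNG.splitCount n + ∑ i ∈ Finset.range (n - 4), SplitNG.splitCount i := by
  open SplitNG in
  have hU : (unlabeledClass n IsUnbalanced).ncard = ∑ i ∈ Finset.range n, splitCount i := by
    rw [← ncard_hasSwing, unlabeledClass_congr fun G => isUnbalanced_iff]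
    rfl
  have hP : (unlabeledClass n HasPentagon).ncard = ∑ i ∈ Finset.range (n - 4), splitCount i := by
    rcases Nat.lt_or_ge n 5 with h | h
    · rw [Nat.sub_eq_zero_of_le (by omega), Finset.sum_range_zero, Set.ncard_eq_zero]
      ext q
      simp only [Set.mem_empty_iff_false, iff_false]
      rintro ⟨G, ⟨f, hf⟩, -⟩
      have := Fintype.card_le_of_injective f hf.inj
      simp only [Fintype.card_fin] at this
      omega
    · obtain ⟨m, rfl⟩ := Nat.exists_eq_add_of_le' h
      -- Here `n = m + 5`, and the sum over `m + 1 = n - 4` terms comes from the swing graphs on `m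
      -- + 1` vertices.
      exact (ncard_hasPentagon m).trans (ncard_hasSwing _)
  have h1 : (unlabeledClass n IsNG1).ncard = splitCount (n - 1) := by
    obtain ⟨m, rfl⟩ := Nat.exists_eq_add_of_le' hn
    exact ncard_isNG1 m
  have h2 : (unlabeledClass n IsNG2).ncard = (unlabeledClass n IsNG1).ncard := by
    refine ncard_unlabeledClass_eq (fun G H => H = Gᶜ) (fun G hG => ⟨Gᶜ, isNG1_compl.2 hG, rfl⟩)
      (fun H hH => ⟨Hᶜ, ?_, (compl_compl H).symm⟩) ?_
    · rwa [← isNG1_compl, compl_compl]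
    · have key : ∀ {G G' : SimpleGraph (Fin n)}, Nonempty (G ≃g G') → Nonempty (Gᶜ ≃g G'ᶜ) := by
        rintro G G' ⟨e⟩
        refine ⟨⟨e.toEquiv, fun {a b} => ?_⟩⟩
        rw [SimpleGraph.compl_adj, SimpleGraph.compl_adj, e.toEquiv.injective.ne_iff]
        exact and_congr_right fun _ => not_congr e.map_adj_iff
      rintro G _ G' _ rfl rfl
      exact ⟨key, fun h => by simpa using key h⟩
  have h3 : ∀ G : SimpleGraph (Fin n), IsNG3 G ↔ HasPentagon G := fun G => isNG3_iff
  refine ⟨hU, ?_, h1, h2.trans h1, ?_, ?_, ?_⟩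
  · have : splitCount n = (unlabeledClass n IsUnbalanced).ncard +
        (unlabeledClass n IsBalanced).ncard := by
      refine ncard_unlabeledClass_or (fun G => ?_) (fun G h => h.2) ?_
      · have : IsBalanced G → IsSplit G := fun ⟨K, S, h, _⟩ => ⟨K, S, h⟩
        simp only [IsUnbalanced]
        tauto
      · rintro G H ⟨e⟩ h
        exact isUnbalanced_iff.2 (HasSwing.map (isUnbalanced_iff.1 h) e)
    rw [this, hU]
    push_cast
    ring
  · rw [unlabeledClass_congr h3, hP]
  · rw [← hP, ← ncard_hasSwing, add_comm]
    refine ncard_unlabeledClass_or (fun G => isNG_iff.trans or_comm)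
      (fun G h => h.not_hasSwing) ?_
    rintro G H ⟨e⟩ h
    exact h.map e
  · rw [← hP, add_comm]
    refine ncard_unlabeledClass_or (fun G => isPseudoSplit_iff.trans or_comm) (fun G h hs => ?_) ?_
    · obtain ⟨f, hf⟩ := h
      obtain ⟨K, hK⟩ := SplitNG.isSplit_iff.1 hs
      exact hK.not_pentagon f hf
    · rintro G H ⟨e⟩ h
      exact h.map e
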